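/- **Definitions.** Let $n,d\ge 1$. A *Simon function* with hidden shift $s\in\mathbb Z_2^n\setminus\{0\}$ is a map $f:\mathbb Z_2^n\to\mathbb Z_2^n$ such that $f(x)=f(y)$ if and only if $y\in\{x,x\oplus s\}$. Identify $\mathbb Z_2^n$ with a subset $S_0$ of $\mathbb Z_2^{(d+2)n}$ by padding with zeros. A *random $(d,f)$-shuffling* is a tuple $\mathcal F=(f_0,\dots,f_d)$, where $f_0,\dots,f_{d-1}$ are independent uniformly random one-to-one functions from $\mathbb Z_2^{(d+2)n}$ to itself, and $f_d$ is the function on $\mathbb Z_2^{(d+2)n}$ with $f_d(f_{d-1}(\cdots f_0(x)))=f(x)$ for $x\in S_0$ and $f_d(y)=\bot$ for $y\notin S_d:=f_{d-1}\circ\cdots\circ f_0(S_0)$. A *$d$-depth quantum circuit with access to $\mathcal F$* on $w$ qubits starts in a standard basis state, applies $U_{d+1}\,\mathcal F\,U_d\cdots\mathcal F\,U_1$, and measures all qubits in the standard basis; each $U_i$ is one layer of one- and two-qubit gates acting on disjoint qubits, and each application of $\mathcal F$ performs any number of parallel queries $|i,x\rangle|y\rangle\mapsto|i,x\rangle|y\oplus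 f_i(x)\rangle$ on disjoint sets of qubits. A *$d$-CQ scheme* with access to $\mathcal F$ is a randomized classical algorithm that can query $f_0,\dots,f_d$ classically and can run $d$-depth quantum circuits with access to $\mathcal F$, chosen adaptively, from which it receives only the measurement outcomes. At the end it outputs a string in $\mathbb Z_2^n$. We bound the number of its classical queries, the number of its circuit runs, and the number of qubits of each circuit; its other classical computation is unrestricted (in particular, polynomial-time classical algorithms are included). **Theorem.** For every polynomial $p$ there is a polynomial $r$ such that the following holds for all $n,d\ge 1$. Let $\mathcal A$ be a $d$-CQ scheme that makes at most $p(n)$ classical queries and runs at most $p(n)$ quantum circuits, each one on at most $p(n)$ qubits. Let $f$ be a uniformly random Simon function on $\mathbb Z_2^n$ with hidden shift $s$, and let $\mathcal F$ be a random $(d,f)$-shuffling. Then $$\Pr[\mathcal A^{\mathcal F}()=s]\;\le\; d\cdot\sqrt{\frac{r(n)}{2^n}},$$ where the probability is over $f$, $\mathcal F$, and the randomness of $\mathcal A$. -/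

import Mathlib

noncomputable section

namespace ShufflingOracle

/-! ### Simon functions and shufflings -/

/-- Bit strings of length `k`; addition is bitwise exclusive or. -/
abbrev Bits (k : ℕ) : Type := Fin k → ZMod 2

/-- `f` is a Simon function with hidden shift `s`: it is two-to-one, and its fibres are the pairs
`{x, x + s}` with `s ≠ 0`. The shift is determined by `f`. -/
def IsSimon {n : ℕ} (s : Bits n) (f : Bits n → Bits n) : Prop :=
  s ≠ 0 ∧ ∀ x y, f x = f y ↔ y = x ∨ y = x + s

open Classical in
/-- All Simon functions on `n` bits, each one together with its hidden shift. -/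
def simonPairs (n : ℕ) : Finset (Bits n × (Bits n → Bits n)) :=
  Finset.univ.filter fun q => IsSimon q.1 q.2

/-- Length of the strings on which the functions of a shuffling are defined. -/
abbrev wordLen (n d : ℕ) : ℕ := (d + 2) * n

theorem le_wordLen (n d : ℕ) : n ≤ wordLen n d := Nat.le_mul_of_pos_left n (by omega)

/-- The inclusion of `{0, …, 2 ^ n - 1}` in the set of all words: padding by zeros. -/
def pad {n : ℕ} (d : ℕ) (x : Bits n) : Bits (wordLen n d) :=
  fun i => if h : (i : ℕ) < n then x ⟨i, h⟩ else 0

/-- The first `n` bits of a word. -/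
def unpad {n d : ℕ} (y : Bits (wordLen n d)) : Bits n := fun i => y (Fin.castLE (le_wordLen n d) i)

/-- A tuple `(f_0, …, f_d)` of functions on words; `none` stands for the value `⊥`. -/
abbrev OracleFn (n d : ℕ) : Type :=
  Fin (d + 1) → Bits (wordLen n d) → Option (Bits (wordLen n d))

/-- The composition `f_{d-1} ∘ ⋯ ∘ f_0`. -/
def chain {n d : ℕ} (g : Fin d → Equiv.Perm (Bits (wordLen n d))) : Equiv.Perm (Bits (wordLen n d)) :=
  (List.finRange d).foldl (fun e j => e.trans (g j)) (Equiv.refl _)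

/-- The `(d, f)`-shuffling given by one-to-one functions `g = (f_0, …, f_{d-1})`.
With `S_0` the set of padded `n`-bit strings and `S_d` its image under `f_{d-1} ∘ ⋯ ∘ f_0`, the last
function `f_d` satisfies `f_d (f_{d-1} (⋯ f_0 x)) = f x` for `x ∈ S_0`, and is `⊥` outside `S_d`. -/
def shuffling {n d : ℕ} (f : Bits n → Bits n) (g : Fin d → Equiv.Perm (Bits (wordLen n d))) :
    OracleFn n d :=
  fun i x =>
    if h : (i : ℕ) < d then some (g ⟨i, h⟩ x)
    else
      if pad d (unpad ((chain g).symm x)) = (chain g).symm x then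
        some (pad d (f (unpad ((chain g).symm x))))
      else none

/-! ### Quantum circuits of depth `d` with oracle access -/

/-- One layer of one- and two-qubit gates on `w` qubits: `gateOf i` is the label of the gate that
acts on qubit `i`. Distinct gates act on disjoint sets of at most two qubits. -/
structure Layer (w : ℕ) where
  gateOf : Fin w → Fin w
  card_le_two : ∀ k, (Finset.univ.filter fun i => gateOf i = k).card ≤ 2
  gate : ∀ k, Matrix.unitaryGroup ({i // gateOf i = k} → ZMod 2) ℂ

/-- The tensor product of the gates of a layer, in the standard basis. -/
def Layer.toMatrix {w : ℕ} (L : Layer w) : Matrix (Bits w) (Bits w) ℂ :=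
  fun a b => ∏ k, (L.gate k).1 (fun i => a i.1) (fun i => b i.1)

/-- The wires of one oracle query: an index in binary, an argument, and a register that receives
the answer. -/
abbrev QueryWire (n d : ℕ) : Type :=
  Fin (Nat.size d) ⊕ (Fin (wordLen n d) ⊕ Fin (wordLen n d + 1))

/-- A round of parallel oracle queries on `w` qubits; different queries use disjoint qubits. -/
structure ParallelQuery (n d w : ℕ) where
  count : ℕ
  wire : Fin count × QueryWire n d ↪ Fin w

/-- The number written in binary by a bit string. -/
def binaryValue {k : ℕ} (b : Bits k) : ℕ := ∑ t, (b t).val * 2 ^ (t : ℕ)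

/-- Answers as bit strings: a word is preceded by the bit `1`, and `⊥` is the zero string. -/
def encodeAnswer {N : ℕ} : Option (Bits N) → Bits (N + 1)
  | none => 0
  | some y => Fin.cons 1 y

/-- The answer to a query whose index is given in binary; indices above `d` are answered by `⊥`. -/
def OracleFn.answer {n d : ℕ} (F : OracleFn n d) (b : Bits (Nat.size d)) (x : Bits (wordLen n d)) :
    Bits (wordLen n d + 1) :=
  encodeAnswer (if h : binaryValue b < d + 1 then F ⟨binaryValue b, h⟩ x else none)

/-- The action `|i, x⟩ |y⟩ ↦ |i, x⟩ |y ⊕ f_i(x)⟩` of parallel queries on a basis state. -/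
def ParallelQuery.act {n d w : ℕ} (Q : ParallelQuery n d w) (F : OracleFn n d) (b : Bits w) :
    Bits w :=
  fun u => b u + ∑ k, ∑ j, if Q.wire (k, .inr (.inr j)) = u then
    F.answer (fun t => b (Q.wire (k, .inl t))) (fun t => b (Q.wire (k, .inr (.inl t)))) j else 0

/-- The unitary matrix of a round of parallel queries. -/
def ParallelQuery.toMatrix {n d w : ℕ} (Q : ParallelQuery n d w) (F : OracleFn n d) :
    Matrix (Bits w) (Bits w) ℂ :=
  fun a b => if Q.act F b = a then 1 else 0

/-- A `d`-depth quantum circuit with oracle access, `U_{d+1} F U_d ⋯ F U_1`, run on a standard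
basis state: `d` rounds of parallel queries between `d + 1` layers of one- and two-qubit gates. -/
structure QCircuit (n d : ℕ) where
  width : ℕ
  input : Bits width
  layer : Fin (d + 1) → Layer width
  parallel : Fin d → ParallelQuery n d width

/-- The state at the end of the circuit. -/
def QCircuit.state {n d : ℕ} (C : QCircuit n d) (F : OracleFn n d) : Bits C.width → ℂ :=
  (List.finRange d).foldl
    (fun ψ k => (C.layer k.succ).toMatrix.mulVec (((C.parallel k).toMatrix F).mulVec ψ))
    ((C.layer 0).toMatrix.mulVec (Pi.single C.input 1))

/-- The probability of the outcome `z` when all qubits are measured in the standard basis. -/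
def QCircuit.outcomeProb {n d : ℕ} (C : QCircuit n d) (F : OracleFn n d) (z : Bits C.width) : ℝ :=
  ‖C.state F z‖ ^ 2

/-! ### Classical algorithms with access to `d`-depth quantum circuits -/

/-- A `d`-CQ scheme with oracle access that outputs an `n`-bit string, as the tree of its possible
runs. The classical algorithm may toss fair coins, query the oracle classically, and run `d`-depth
quantum circuits, of which it learns the measurement outcome; what it does next may depend in any
way on everything classical that it has seen so far. The coin and query nodes between two runs of
quantum circuits form one of the classical algorithms `A_{c,i}`. -/
inductive CQScheme (n d : ℕ) : Type where
  | output (z : Bits n)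
  | coin (next : Bool → CQScheme n d)
  | query (i : Fin (d + 1)) (x : Bits (wordLen n d))
      (next : Option (Bits (wordLen n d)) → CQScheme n d)
  | circuit (C : QCircuit n d) (next : Bits C.width → CQScheme n d)

namespace CQScheme

variable {n d : ℕ}

/-- The largest number of quantum circuits used in a run. -/
def circuitCount : CQScheme n d → ℕ
  | output _ => 0
  | coin next => Finset.univ.sup fun b => (next b).circuitCount
  | query _ _ next => Finset.univ.sup fun y => (next y).circuitCount
  | circuit _ next => 1 + Finset.univ.sup fun z => (next z).circuitCount

/-- The largest number of classical oracle queries in a run. -/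
def queryCount : CQScheme n d → ℕ
  | output _ => 0
  | coin next => Finset.univ.sup fun b => (next b).queryCount
  | query _ _ next => 1 + Finset.univ.sup fun y => (next y).queryCount
  | circuit _ next => Finset.univ.sup fun z => (next z).queryCount

/-- The largest number of qubits in one of the quantum circuits. -/
def maxWidth : CQScheme n d → ℕ
  | output _ => 0
  | coin next => Finset.univ.sup fun b => (next b).maxWidth
  | query _ _ next => Finset.univ.sup fun y => (next y).maxWidth
  | circuit C next => max C.width (Finset.univ.sup fun z => (next z).maxWidth)

/-- The probability that the scheme outputs `s` when its oracle is `F`. -/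
def outputProb (F : OracleFn n d) (s : Bits n) : CQScheme n d → ℝ
  | output z => if z = s then 1 else 0
  | coin next => ((next false).outputProb F s + (next true).outputProb F s) / 2
  | query i x next => (next (F i x)).outputProb F s
  | circuit C next => ∑ z, C.outcomeProb F z * (next z).outputProb F s

/-- The probability that the scheme outputs the hidden shift, over a uniformly random Simon
function `f`, independent uniformly random one-to-one functions `f_0, …, f_{d-1}`, and the
randomness of the scheme. -/
def successProb (A : CQScheme n d) : ℝ :=
  (∑ q ∈ simonPairs n, ∑ g : Fin d → Equiv.Perm (Bits (wordLen n d)),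
      A.outputProb (shuffling q.2 g) q.1) /
    ((simonPairs n).card * Fintype.card (Fin d → Equiv.Perm (Bits (wordLen n d))))

end CQScheme

end ShufflingOracle

end

open ShufflingOracle

/-! Call the images of a word `v` under `stage g i` the path of `v`. Only the paths that start at
padded strings lead to values of `f`, and a circuit has one round of queries too few to follow such
a path through all `d + 1` functions. This is made quantitative with a shrinking chain of sets `nest
n d l` that contain all padded strings, each a fraction `2 ^ (-n)` of the one before.

For a fixed circuit and fixed `f`, the hybrid run answers round `j` (counted from 0) with an oracle
that hides the paths through `nest n d (j + 1)` from level `j + 1` on. Words whose path carries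
query weight at least `θ` are opened first. Exchanging the paths of two hidden words after level `j`
does not change the first `j` rounds (`hybrid_twist`), so the hidden part of `nest n d (j + 1)` sits
in that of `nest n d j` like a random sparse subset. With `θ = 2 a / 2 ^ n`, its total load is then
bounded on average, and an exponential moment gives a tail of order `2 ^ (-k)`
(`sum_prod_one_add_le`, `card_lt_totalLoad_le`). If no round has load above `k`, at most `d * k`
words are opened and the hybrid run is close to the true one (`sum_abs_outcomeProb_sub_le`).

The circuits are chosen adaptively, after classical queries that already reveal part of `g`. The
exponential tail pays for this: `k` is so large that a union bound over every circuit in the tree of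
the scheme succeeds (`sum_overloadCount_le`).

For fixed `g`, a hybrid run needs `f` only at opened words, so the whole scheme becomes a randomized
algorithm with polynomially many classical queries to `f` (`decisionTree_simProb`). The shifts not
excluded by collisions stay equally likely, so `K` such queries find the shift with probability at
most `(1 + K ^ 2) / (2 ^ n - 1)` (`DecisionTree.sum_simonPairs_le`). `successProb_le` adds the three
errors. -/

noncomputable section

namespace ShufflingOracle

open Finset

/-! ### Euclidean norm of state vectors -/

/-- The Euclidean norm of a vector of amplitudes. -/
def l2 {ι : Type*} [Fintype ι] (ψ : ι → ℂ) : ℝ := ‖(WithLp.toLp 2 ψ : EuclideanSpace ℂ ι)‖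

section Norm

variable {ι : Type*} [Fintype ι]

theorem l2_nonneg (ψ : ι → ℂ) : 0 ≤ l2 ψ := norm_nonneg _

theorem l2_sq (ψ : ι → ℂ) : l2 ψ ^ 2 = ∑ b, ‖ψ b‖ ^ 2 := EuclideanSpace.norm_sq_eq _

theorem l2_add_le (ψ φ : ι → ℂ) : l2 (ψ + φ) ≤ l2 ψ + l2 φ := by
  unfold l2; rw [WithLp.toLp_add]; exact norm_add_le _ _

theorem l2_sub_le_add (a b c : ι → ℂ) : l2 (a - c) ≤ l2 (a - b) + l2 (b - c) := by
  simpa using l2_add_le (a - b) (b - c)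

theorem l2_eq_of_sum_eq {κ : Type*} [Fintype κ] {ψ : ι → ℂ} {φ : κ → ℂ}
    (h : ∑ b, ‖ψ b‖ ^ 2 = ∑ b, ‖φ b‖ ^ 2) : l2 ψ = l2 φ := by
  rw [← abs_of_nonneg (l2_nonneg ψ), ← abs_of_nonneg (l2_nonneg φ), ← sq_eq_sq_iff_abs_eq_abs,
    l2_sq, l2_sq, h]

theorem sum_norm_sq_mulVec [DecidableEq ι] {M : Matrix ι ι ℂ} (hM : M.conjTranspose * M = 1)
    (ψ : ι → ℂ) : ∑ b, ‖M.mulVec ψ b‖ ^ 2 = ∑ b, ‖ψ b‖ ^ 2 := by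
  have key : ∀ φ : ι → ℂ, ((∑ b, ‖φ b‖ ^ 2 : ℝ) : ℂ) = star φ ⬝ᵥ φ := by
    intro φ
    simp only [dotProduct, Pi.star_apply, Complex.ofReal_sum, Complex.ofReal_pow]
    refine Finset.sum_congr rfl fun b _ => ?_
    rw [RCLike.star_def, RCLike.conj_mul]; rfl
  have : ((∑ b, ‖M.mulVec ψ b‖ ^ 2 : ℝ) : ℂ) = ((∑ b, ‖ψ b‖ ^ 2 : ℝ) : ℂ) := by
    rw [key, key, Matrix.star_mulVec, ← Matrix.dotProduct_mulVec, Matrix.mulVec_mulVec, hM,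
      Matrix.one_mulVec]
  exact_mod_cast this

theorem l2_mulVec [DecidableEq ι] {M : Matrix ι ι ℂ} (hM : M.conjTranspose * M = 1) (ψ : ι → ℂ) :
    l2 (M.mulVec ψ) = l2 ψ := l2_eq_of_sum_eq (sum_norm_sq_mulVec hM ψ)

/-- Close unit vectors have close measurement statistics. -/
theorem sum_abs_sub_norm_sq_le (ψ φ : ι → ℂ) :
    ∑ b, |‖ψ b‖ ^ 2 - ‖φ b‖ ^ 2| ≤ l2 (ψ - φ) * (l2 ψ + l2 φ) := by
  have h1 : ∀ b, |‖ψ b‖ ^ 2 - ‖φ b‖ ^ 2| ≤ ‖(ψ - φ) b‖ * ‖ψ b‖ + ‖(ψ - φ) b‖ * ‖φ b‖ := by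
    intro b
    rw [sq_sub_sq, abs_mul, abs_of_nonneg (by positivity : 0 ≤ ‖ψ b‖ + ‖φ b‖), ← mul_add, mul_comm]
    exact mul_le_mul_of_nonneg_right (abs_norm_sub_norm_le _ _) (by positivity)
  have h2 : ∀ a c : ι → ℂ, ∑ b, ‖a b‖ * ‖c b‖ ≤ l2 a * l2 c := by
    intro a c
    refine abs_le_of_sq_le_sq' ?_ (mul_nonneg (l2_nonneg _) (l2_nonneg _)) |>.2
    rw [mul_pow, l2_sq, l2_sq]
    exact Finset.sum_mul_sq_le_sq_mul_sq _ _ _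
  calc _ ≤ ∑ b, (‖(ψ - φ) b‖ * ‖ψ b‖ + ‖(ψ - φ) b‖ * ‖φ b‖) := Finset.sum_le_sum fun b _ => h1 b
    _ ≤ l2 (ψ - φ) * l2 ψ + l2 (ψ - φ) * l2 φ := by
      rw [Finset.sum_add_distrib]; exact add_le_add (h2 _ _) (h2 _ _)
    _ = _ := by ring

end Norm

/-! ### Layers of gates and rounds of queries are isometries -/

/-- A basis state is a family of local basis states, one for each gate, so the sum over states of a
product over gates is a product of local sums. Each of these is an entry of an identity matrix. -/
theorem Layer.conjTranspose_mul_self {w : ℕ} (L : Layer w) :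
    L.toMatrix.conjTranspose * L.toMatrix = 1 := by
  ext a b
  let U : ∀ k, Matrix ({i // L.gateOf i = k} → ZMod 2) ({i // L.gateOf i = k} → ZMod 2) ℂ :=
    fun k => (L.gate k).1
  have hgate : ∀ k, (U k).conjTranspose * U k = 1 := fun k =>
    Matrix.mem_unitaryGroup_iff'.1 (L.gate k).2
  let E : Bits w ≃ ∀ k, {i // L.gateOf i = k} → ZMod 2 :=
    { toFun := fun c k i => c i.1
      invFun := fun c i => c (L.gateOf i) ⟨i, rfl⟩
      left_inv := fun c => rfl
      right_inv := fun c => by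
        funext k i
        obtain ⟨i, rfl⟩ := i
        rfl }
  have h0 : ∀ c e : Bits w, L.toMatrix c e = ∏ k, U k (E c k) (E e k) := fun _ _ => rfl
  have h1 : (L.toMatrix.conjTranspose * L.toMatrix) a b
      = ∑ c : Bits w, ∏ k, star (U k (E c k) (E a k)) * U k (E c k) (E b k) := by
    rw [Matrix.mul_apply]
    refine Finset.sum_congr rfl fun c _ => ?_
    rw [Matrix.conjTranspose_apply, h0, h0, star_prod, ← Finset.prod_mul_distrib]
  rw [h1, E.sum_comp (fun x => ∏ k, star (U k (x k) (E a k)) * U k (x k) (E b k)),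
    ← Fintype.prod_sum fun k x => star (U k x (E a k)) * U k x (E b k)]
  have h2 : ∀ k, ∑ x, star (U k x (E a k)) * U k x (E b k)
      = (1 : Matrix _ _ ℂ) (E a k) (E b k) := by
    intro k
    rw [← hgate k, Matrix.mul_apply]; rfl
  rw [Finset.prod_congr rfl fun k _ => h2 k]
  by_cases hab : a = b
  · subst hab; simp
  · rw [Matrix.one_apply_ne hab]
    have : ∃ k, E a k ≠ E b k := by
      by_contra! h
      exact hab (E.injective (funext h))
    obtain ⟨k, hk⟩ := this
    exact Finset.prod_eq_zero (Finset.mem_univ k) (Matrix.one_apply_ne hk)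

namespace ParallelQuery

variable {n d w : ℕ} (Q : ParallelQuery n d w)

/-- The index asked by the `k`-th query of a round. -/
def index (b : Bits w) (k : Fin Q.count) : ℕ := binaryValue fun t => b (Q.wire (k, .inl t))

/-- The argument of the `k`-th query of a round. -/
def arg (b : Bits w) (k : Fin Q.count) : Bits (wordLen n d) :=
  fun t => b (Q.wire (k, .inr (.inl t)))

theorem act_wire_inl (F : OracleFn n d) (b : Bits w) (k : Fin Q.count) (t) :
    Q.act F b (Q.wire (k, .inl t)) = b (Q.wire (k, .inl t)) := by
  simp [act]

theorem act_wire_inr_inl (F : OracleFn n d) (b : Bits w) (k : Fin Q.count) (t) :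
    Q.act F b (Q.wire (k, .inr (.inl t))) = b (Q.wire (k, .inr (.inl t))) := by
  simp [act]

@[simp] theorem index_act (F : OracleFn n d) (b : Bits w) (k : Fin Q.count) :
    Q.index (Q.act F b) k = Q.index b k := by
  simp [index, act_wire_inl]

@[simp] theorem arg_act (F : OracleFn n d) (b : Bits w) (k : Fin Q.count) :
    Q.arg (Q.act F b) k = Q.arg b k := by
  funext t; simp [arg, act_wire_inr_inl]

theorem act_involutive (F : OracleFn n d) : Function.Involutive (Q.act F) := by
  intro b
  funext u
  have h : Q.act F (Q.act F b) u = Q.act F b u + (Q.act F b u - b u) := by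
    conv_lhs => rw [act]
    simp only [act_wire_inl, act_wire_inr_inl]
    simp only [act, add_sub_cancel_left]
  rw [h, add_sub, CharTwo.add_self_eq_zero, zero_sub, CharTwo.neg_eq]

theorem mulVec_eq (F : OracleFn n d) (ψ : Bits w → ℂ) (a : Bits w) :
    (Q.toMatrix F).mulVec ψ a = ψ (Q.act F a) := by
  rw [Matrix.mulVec, dotProduct, Finset.sum_eq_single (Q.act F a)]
  · simp [toMatrix, Q.act_involutive F a]
  · intro b _ hb
    have : Q.act F b ≠ a := fun h => hb (by rw [← h, Q.act_involutive F b])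
    simp [toMatrix, this]
  · simp

theorem l2_mulVec_eq (F : OracleFn n d) (ψ : Bits w → ℂ) :
    l2 ((Q.toMatrix F).mulVec ψ) = l2 ψ := by
  refine l2_eq_of_sum_eq ?_
  simp only [mulVec_eq]
  exact Equiv.sum_comp (Q.act_involutive F).toPerm fun b => ‖ψ b‖ ^ 2

theorem l2_mulVec_sub_mulVec_eq (F : OracleFn n d) (ψ φ : Bits w → ℂ) :
    l2 ((Q.toMatrix F).mulVec ψ - (Q.toMatrix F).mulVec φ) = l2 (ψ - φ) := by
  rw [← Matrix.mulVec_sub, l2_mulVec_eq]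

/-- The query magnitude of `(i, u)` on a state: the expected number of queries for the value of
`f_i` at `u`. -/
def weight (φ : Bits w → ℂ) (i : ℕ) (u : Bits (wordLen n d)) : ℝ :=
  ∑ b, ∑ k, if Q.index b k = i ∧ Q.arg b k = u then ‖φ b‖ ^ 2 else 0

theorem weight_nonneg (φ : Bits w → ℂ) (i : ℕ) (u : Bits (wordLen n d)) : 0 ≤ Q.weight φ i u :=
  Finset.sum_nonneg fun _ _ => Finset.sum_nonneg fun _ _ => by split_ifs <;> positivity

/-- In a given basis state every parallel query asks exactly one question. -/
theorem sum_weight_le (φ : Bits w → ℂ) (I : Finset (ℕ × Bits (wordLen n d))) :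
    ∑ p ∈ I, Q.weight φ p.1 p.2 ≤ Q.count * l2 φ ^ 2 := by
  unfold weight
  rw [Finset.sum_comm, l2_sq, Finset.mul_sum]
  refine Finset.sum_le_sum fun b _ => ?_
  rw [Finset.sum_comm]
  calc _ ≤ ∑ _k : Fin Q.count, ‖φ b‖ ^ 2 := by
        refine Finset.sum_le_sum fun k _ => ?_
        have : ∀ p : ℕ × Bits (wordLen n d), (Q.index b k = p.1 ∧ Q.arg b k = p.2) ↔
            p = (Q.index b k, Q.arg b k) := by
          intro p; rw [Prod.ext_iff]; constructor <;> rintro ⟨h, h'⟩ <;> exact ⟨h.symm, h'.symm⟩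
        simp only [this]
        rw [Finset.sum_ite_eq']
        split_ifs
        · exact le_rfl
        · positivity
    _ = _ := by simp

/-- Changing the answers to some questions changes the state after a round by an amount that is
controlled by the query magnitude of these questions. -/
theorem l2_mulVec_sub_le (F G : OracleFn n d) (φ : Bits w → ℂ)
    (I : Finset (ℕ × Bits (wordLen n d)))
    (hI : ∀ (i : Fin (d + 1)) u, F i u ≠ G i u → ((i : ℕ), u) ∈ I) :
    l2 ((Q.toMatrix F).mulVec φ - (Q.toMatrix G).mulVec φ) ^ 2
      ≤ 4 * ∑ p ∈ I, Q.weight φ p.1 p.2 := by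
  classical
  -- A query does not change its index and argument registers, so `B` is invariant under both
  -- oracles, and outside `B` they act alike.
  let B : Finset (Bits w) := Finset.univ.filter fun b => ∃ k, (Q.index b k, Q.arg b k) ∈ I
  have hact : ∀ b, b ∉ B → Q.act F b = Q.act G b := by
    intro b hb
    have hb' : ∀ k, (Q.index b k, Q.arg b k) ∉ I := by simpa [B] using hb
    funext u
    unfold act
    congr 1
    refine Finset.sum_congr rfl fun k _ => Finset.sum_congr rfl fun j _ => ?_
    have : F.answer (fun t => b (Q.wire (k, .inl t))) (fun t => b (Q.wire (k, .inr (.inl t))))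
        = G.answer (fun t => b (Q.wire (k, .inl t))) (fun t => b (Q.wire (k, .inr (.inl t)))) := by
      unfold OracleFn.answer
      split_ifs with h
      · by_contra hne
        refine hb' k (hI ⟨_, h⟩ _ fun heq => hne ?_)
        unfold arg at heq
        rw [heq]
      · rfl
    rw [this]
  have hmass : ∀ H : OracleFn n d, ∑ b ∈ B, ‖φ (Q.act H b)‖ ^ 2 = ∑ b ∈ B, ‖φ b‖ ^ 2 := by
    intro H
    refine Finset.sum_equiv (Q.act_involutive H).toPerm ?_ ?_
    · intro b; simp [B]
    · intro b _; rfl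
  have hB : ∑ b ∈ B, ‖φ b‖ ^ 2 ≤ ∑ p ∈ I, Q.weight φ p.1 p.2 := by
    unfold weight
    rw [Finset.sum_comm]
    refine (Finset.sum_le_sum (g := fun b => ∑ p ∈ I, ∑ k,
      if Q.index b k = p.1 ∧ Q.arg b k = p.2 then ‖φ b‖ ^ 2 else 0) fun b hb => ?_).trans
      (Finset.sum_le_sum_of_subset_of_nonneg (Finset.subset_univ _) fun b _ _ =>
        Finset.sum_nonneg fun _ _ => Finset.sum_nonneg fun _ _ => by split_ifs <;> positivity)
    obtain ⟨k, hk⟩ := (Finset.mem_filter.1 hb).2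
    refine le_trans ?_ (Finset.single_le_sum (fun p _ => Finset.sum_nonneg fun k _ => ?_) hk)
    · refine le_trans ?_ (Finset.single_le_sum (fun k _ => ?_) (Finset.mem_univ k))
      · simp
      · dsimp only; split_ifs <;> positivity
    · split_ifs <;> positivity
  rw [l2_sq]
  calc ∑ b, ‖((Q.toMatrix F).mulVec φ - (Q.toMatrix G).mulVec φ) b‖ ^ 2
      = ∑ b ∈ B, ‖φ (Q.act F b) - φ (Q.act G b)‖ ^ 2 := by
        symm
        simp only [Pi.sub_apply, mulVec_eq]
        refine Finset.sum_subset (Finset.subset_univ _) fun b _ hb => ?_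
        rw [hact b hb]; simp
    -- The factor 4 is the 2 from `‖u - v‖² ≤ 2 (‖u‖² + ‖v‖²)` times the two terms, each of which
    -- has the mass of `φ` on `B`.
    _ ≤ ∑ b ∈ B, 2 * (‖φ (Q.act F b)‖ ^ 2 + ‖φ (Q.act G b)‖ ^ 2) := by
        refine Finset.sum_le_sum fun b _ => ?_
        have := norm_sub_le (φ (Q.act F b)) (φ (Q.act G b))
        have h0 := norm_nonneg (φ (Q.act F b) - φ (Q.act G b))
        nlinarith [sq_nonneg (‖φ (Q.act F b)‖ - ‖φ (Q.act G b)‖)]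
    _ = 4 * ∑ b ∈ B, ‖φ b‖ ^ 2 := by
        rw [← Finset.mul_sum, Finset.sum_add_distrib, hmass, hmass]; ring
    _ ≤ _ := by gcongr

theorem count_mul_le : Q.count * (2 * wordLen n d + 1) ≤ w := by
  have := Fintype.card_le_of_embedding Q.wire
  simp only [Fintype.card_prod, Fintype.card_sum, Fintype.card_fin] at this
  exact le_trans (Nat.mul_le_mul_left _ (by omega)) this

theorem count_le : Q.count ≤ w := le_trans (Nat.le_mul_of_pos_right _ (by omega)) Q.count_mul_le

/-- A single query occupies more than `d + 2` wires. This settles depths that are not bounded by the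
polynomial `p`. -/
theorem count_eq_zero (hn : 1 ≤ n) (hw : w < d + 2) : Q.count = 0 := by
  by_contra h
  have h1 := Q.count_mul_le
  have h2 : d + 2 ≤ wordLen n d := Nat.le_mul_of_pos_right _ hn
  have h3 : 2 * wordLen n d + 1 ≤ w := le_trans (Nat.le_mul_of_pos_left _ (by omega)) h1
  omega

end ParallelQuery

section Chain

/-! ### Initial segments of the chain of permutations -/

/-- Replaces a fold by a sequence indexed by `ℕ`, on which induction over the levels or rounds is
possible. -/
theorem foldl_finRange_eq {α : Type*} : ∀ (d : ℕ) (step : α → Fin d → α) (s : ℕ → α),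
    (∀ j : Fin d, s (j + 1) = step (s j) j) → (List.finRange d).foldl step (s 0) = s d
  | 0, _, _, _ => by simp
  | d + 1, step, s, h => by
    rw [List.finRange_succ_last, List.foldl_append, List.foldl_map,
      foldl_finRange_eq d (fun a j => step a j.castSucc) s fun j => h j.castSucc]
    simpa using (h (Fin.last d)).symm

/-- The composition `f_{i-1} ∘ ⋯ ∘ f_0`. -/
def stage {n d : ℕ} (g : Fin d → Equiv.Perm (Bits (wordLen n d))) :
    ℕ → Equiv.Perm (Bits (wordLen n d))
  | 0 => Equiv.refl _
  | i + 1 => if h : i < d then (stage g i).trans (g ⟨i, h⟩) else stage g i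

section Stage

variable {n d : ℕ} (g : Fin d → Equiv.Perm (Bits (wordLen n d)))

theorem stage_succ (j : Fin d) : stage g (j + 1) = (stage g j).trans (g j) := by
  rw [stage, dif_pos j.2]

theorem chain_eq_stage : chain g = stage g d := by
  unfold chain
  exact foldl_finRange_eq d (fun e j => e.trans (g j)) (stage g) fun j => stage_succ g j

/-- The tuple `g` with the domain of its `j`-th function twisted by the transposition that
exchanges the images of `a` and `c`. -/
def twist (j : Fin d) (a c : Bits (wordLen n d)) : Fin d → Equiv.Perm (Bits (wordLen n d)) :=
  Function.update g j ((Equiv.swap (stage g j a) (stage g j c)).trans (g j))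

variable {g}

theorem twist_of_ne {j i : Fin d} (h : i ≠ j) (a c : Bits (wordLen n d)) :
    twist g j a c i = g i := by
  simp [twist, h]

theorem stage_twist_of_le {j : Fin d} (a c : Bits (wordLen n d)) :
    ∀ {i : ℕ}, i ≤ j → stage (twist g j a c) i = stage g i
  | 0, _ => rfl
  | i + 1, h => by
    have hi : i < d := by omega
    have hne : (⟨i, hi⟩ : Fin d) ≠ j := by rintro rfl; simp at h
    rw [stage, stage, dif_pos hi, dif_pos hi, twist_of_ne hne, stage_twist_of_le a c (by omega)]

/-- Exchanging two inputs of the `j`-th function exchanges the two paths after level `j`, which has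
the same effect there as exchanging their starting points. -/
theorem stage_twist_of_gt {j : Fin d} (a c : Bits (wordLen n d)) (i : ℕ) (h : (j : ℕ) < i) :
    stage (twist g j a c) i = (Equiv.swap a c).trans (stage g i) := by
  induction i, h using Nat.le_induction with
  | base =>
    rw [stage_succ, stage_succ, stage_twist_of_le a c le_rfl]
    ext1 v
    simp only [twist, Function.update_self, Equiv.trans_apply]
    rw [(stage g j).injective.swap_apply]
  | succ i hi ih =>
    rw [stage, stage]
    split_ifs with h
    · rw [ih, twist_of_ne (by rintro rfl; simp at hi)]; rfl
    · exact ih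

theorem twist_twist (j : Fin d) (a c : Bits (wordLen n d)) :
    twist (twist g j a c) j a c = g := by
  funext i
  by_cases h : i = j
  · subst h
    unfold twist
    rw [Function.update_self, Function.update_self]
    have := stage_twist_of_le (g := g) (j := i) a c le_rfl
    unfold twist at this
    rw [this]
    ext1 v; simp
  · rw [twist_of_ne h, twist_of_ne h]

end Stage

/-! ### Nested sets of words -/

/-- The words that vanish after the first `(d + 2 - l) n` bits. -/
def nest (n d l : ℕ) : Finset (Bits (wordLen n d)) :=
  univ.filter fun y => ∀ i : Fin (wordLen n d), (d + 2 - l) * n ≤ (i : ℕ) → y i = 0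

theorem nest_anti (n d : ℕ) {l m : ℕ} (h : l ≤ m) : nest n d m ⊆ nest n d l := by
  intro y
  simp only [nest, mem_filter, mem_univ, true_and]
  exact fun hy i hi => hy i (le_trans (Nat.mul_le_mul_right _ (by omega)) hi)

/-- Consecutive sizes have ratio `2 ^ n`, the sparsity on which the tail bound rests. -/
theorem card_nest (n d l : ℕ) : (nest n d l).card = 2 ^ ((d + 2 - l) * n) := by
  have h : nest n d l = Fintype.piFinset fun i : Fin (wordLen n d) =>
      if (d + 2 - l) * n ≤ (i : ℕ) then ({0} : Finset (ZMod 2)) else univ := by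
    ext y
    simp only [nest, mem_filter, mem_univ, true_and, Fintype.mem_piFinset]
    refine forall_congr' fun i => ?_
    split_ifs with hi <;> simp [hi]
  rw [h, Fintype.card_piFinset]
  have h2 : ∀ i : Fin (wordLen n d), (if (d + 2 - l) * n ≤ (i : ℕ) then ({0} : Finset (ZMod 2))
      else univ).card = if (i : ℕ) < (d + 2 - l) * n then 2 else 1 := by
    intro i
    by_cases hi : (d + 2 - l) * n ≤ (i : ℕ)
    · simp [hi, not_lt.2 hi]
    · simp [hi, not_le.1 hi, ZMod.card]
  rw [Finset.prod_congr rfl fun i _ => h2 i, Finset.prod_ite, Finset.prod_const, Finset.prod_const,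
    one_pow, mul_one, Fin.card_filter_val_lt]
  congr 1
  exact min_eq_right (Nat.mul_le_mul_right _ (by omega))

theorem pad_mem_nest {n d l : ℕ} (h : l ≤ d) (x : Bits n) : pad d x ∈ nest n d l := by
  simp only [nest, mem_filter, mem_univ, true_and]
  intro i hi
  have : n ≤ (d + 2 - l) * n := Nat.le_mul_of_pos_left _ (by omega)
  rw [pad, dif_neg (by omega)]

/-! ### Counting with transpositions -/

/-- If transpositions of `A` act on a family of weight functions, then the weights of few elements
of `A` are on average small, with an exponential tail. -/
theorem sum_prod_one_add_le {G α : Type*} [DecidableEq α] (S : Finset G) (A : Finset α)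
    (T : α → α → G → G) (hT : ∀ a ∈ A, ∀ c ∈ A, ∀ g ∈ S, T a c g ∈ S)
    (hTT : ∀ a c g, T a c (T a c g) = g) (y : G → α → ℝ) (hy : ∀ g v, 0 ≤ y g v)
    (hyT : ∀ a ∈ A, ∀ c ∈ A, ∀ g ∈ S, ∀ v, y (T a c g) v = y g (Equiv.swap a c v)) (Y : ℝ)
    (hY : ∀ g ∈ S, ∑ v ∈ A, y g v ≤ Y) {m : ℝ} (hm : 0 < m) (B : Finset α) (hBA : B ⊆ A)
    (hB : B.card + m ≤ A.card) :
    ∑ g ∈ S, ∏ v ∈ B, (1 + y g v) ≤ S.card * (1 + Y / m) ^ B.card := by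
  induction B using Finset.induction_on with
  | empty => simp
  | insert b B hb ih =>
    have hBA' : B ⊆ A := (Finset.subset_insert _ _).trans hBA
    have hbA : b ∈ A := hBA (Finset.mem_insert_self _ _)
    rw [Finset.card_insert_of_notMem hb] at hB
    push_cast at hB
    have ih := ih hBA' (by linarith)
    set P : G → ℝ := fun g => ∏ v ∈ B, (1 + y g v) with hP
    have hP0 : ∀ g, 0 ≤ P g := fun g => Finset.prod_nonneg fun v _ => by linarith [hy g v]
    -- The transposition of `b` and `c` fixes every element of `B`, so it moves the weight from `b`
    -- to `c` without changing the product over `B`.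
    have hswap : ∀ c ∈ A \ B, ∑ g ∈ S, y g c * P g = ∑ g ∈ S, y g b * P g := by
      intro c hc
      rw [Finset.mem_sdiff] at hc
      refine Finset.sum_nbij' (T b c) (T b c) (hT b hbA c hc.1) (hT b hbA c hc.1)
        (fun g _ => hTT b c g) (fun g _ => hTT b c g) fun g hg => ?_
      rw [hyT b hbA c hc.1 g hg, Equiv.swap_apply_left]
      congr 1
      refine Finset.prod_congr rfl fun v hv => ?_
      rw [hyT b hbA c hc.1 g hg, Equiv.swap_apply_of_ne_of_ne]
      · rintro rfl; exact hb hv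
      · rintro rfl; exact hc.2 hv
    have hcard : m ≤ (A \ B).card := by
      rw [Finset.card_sdiff_of_subset hBA', Nat.cast_sub (Finset.card_le_card hBA')]
      linarith
    have h1 : m * ∑ g ∈ S, y g b * P g ≤ Y * ∑ g ∈ S, P g := by
      calc m * ∑ g ∈ S, y g b * P g ≤ (A \ B).card * ∑ g ∈ S, y g b * P g :=
            mul_le_mul_of_nonneg_right hcard
              (Finset.sum_nonneg fun g _ => mul_nonneg (hy _ _) (hP0 _))
        _ = ∑ c ∈ A \ B, ∑ g ∈ S, y g c * P g := by
            rw [Finset.sum_congr rfl hswap, Finset.sum_const, nsmul_eq_mul]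
        _ = ∑ g ∈ S, (∑ c ∈ A \ B, y g c) * P g := by
            rw [Finset.sum_comm]; simp only [Finset.sum_mul]
        _ ≤ ∑ g ∈ S, Y * P g := by
            refine Finset.sum_le_sum fun g hg => mul_le_mul_of_nonneg_right ?_ (hP0 g)
            exact (Finset.sum_le_sum_of_subset_of_nonneg Finset.sdiff_subset
              fun v _ _ => hy g v).trans (hY g hg)
        _ = _ := by rw [Finset.mul_sum]
    have h2 : ∑ g ∈ S, y g b * P g ≤ Y / m * ∑ g ∈ S, P g := by
      rw [div_mul_eq_mul_div, le_div_iff₀ hm]; linarith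
    -- `Y` is known to be nonnegative only if some `g` exists.
    have hYm : 0 ≤ Y / m ∨ S = ∅ := by
      rcases S.eq_empty_or_nonempty with h | ⟨g, hg⟩
      · exact Or.inr h
      · exact Or.inl (div_nonneg ((Finset.sum_nonneg fun v _ => hy g v).trans (hY g hg)) hm.le)
    rcases hYm with hYm | rfl
    · simp only [Finset.prod_insert hb]
      rw [Finset.card_insert_of_notMem hb]
      calc ∑ g ∈ S, (1 + y g b) * P g = ∑ g ∈ S, P g + ∑ g ∈ S, y g b * P g := by
            rw [← Finset.sum_add_distrib]; exact Finset.sum_congr rfl fun g _ => by ring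
        _ ≤ (1 + Y / m) * ∑ g ∈ S, P g := by linarith
        _ ≤ (1 + Y / m) * (S.card * (1 + Y / m) ^ B.card) := by gcongr
        _ = _ := by ring
    · simp

/-- Turns the product in `sum_prod_one_add_le` into an exponential moment, by Bernoulli's inequality
`2 ^ y ≤ 1 + y` on `[0, 1]`. The loads are truncated at 1 for its sake. -/
theorem two_rpow_sum_le_prod {α : Type*} (B : Finset α) (y : α → ℝ) (h0 : ∀ v, 0 ≤ y v)
    (h1 : ∀ v, y v ≤ 1) : (2 : ℝ) ^ (∑ v ∈ B, y v) ≤ ∏ v ∈ B, (1 + y v) := by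
  rw [Real.rpow_sum_of_pos two_pos]
  refine Finset.prod_le_prod (fun v _ => by positivity) fun v _ => ?_
  have := rpow_one_add_le_one_add_mul_self (s := 1) (by norm_num) (h0 v) (h1 v)
  norm_num at this
  exact this

end Chain

section Hybrid

/-! ### Blocked oracles and hybrid runs -/

variable {n d : ℕ}

open Classical in
/-- The shuffling oracle with the paths through `nest n d l` hidden from the level `l` on, except
for the paths that start in the set `O` of open words. -/
def blockedOracle (f : Bits n → Bits n) (g : Fin d → Equiv.Perm (Bits (wordLen n d))) (l : ℕ)
    (O : Finset (Bits (wordLen n d))) : OracleFn n d :=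
  fun i x => if l ≤ (i : ℕ) ∧ (stage g i).symm x ∈ nest n d l \ O then none else shuffling f g i x

theorem shuffling_of_lt (f : Bits n → Bits n) (g : Fin d → Equiv.Perm (Bits (wordLen n d)))
    {i : Fin (d + 1)} (h : (i : ℕ) < d) (x : Bits (wordLen n d)) :
    shuffling f g i x = some (g ⟨i, h⟩ x) := dif_pos h

theorem shuffling_of_not_lt (f : Bits n → Bits n) (g : Fin d → Equiv.Perm (Bits (wordLen n d)))
    {i : Fin (d + 1)} (h : ¬(i : ℕ) < d) (x : Bits (wordLen n d)) :
    shuffling f g i x = if pad d (unpad ((stage g d).symm x)) = (stage g d).symm x then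
      some (pad d (f (unpad ((stage g d).symm x)))) else none := by
  rw [← chain_eq_stage]; exact dif_neg h

/-- The `j`-th function changes only at inputs on hidden paths, where the answer is `⊥` anyway. At
later levels the set of hidden inputs is preserved, and visible paths are fixed by the
transposition. -/
theorem blockedOracle_twist (f : Bits n → Bits n) (g : Fin d → Equiv.Perm (Bits (wordLen n d)))
    {l : ℕ} {j : Fin d} (hl : l ≤ j) {O : Finset (Bits (wordLen n d))} {a c : Bits (wordLen n d)}
    (ha : a ∈ nest n d l \ O) (hc : c ∈ nest n d l \ O) :
    blockedOracle f (twist g j a c) l O = blockedOracle f g l O := by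
  funext i x
  unfold blockedOracle
  have hswap : ∀ v, Equiv.swap a c v ∈ nest n d l \ O ↔ v ∈ nest n d l \ O := by
    intro v
    rcases eq_or_ne v a with rfl | hva
    · simp only [Equiv.swap_apply_left, ha, hc]
    rcases eq_or_ne v c with rfl | hvc
    · simp only [Equiv.swap_apply_right, ha, hc]
    · rw [Equiv.swap_apply_of_ne_of_ne hva hvc]
  have hfix : ∀ v, v ∉ nest n d l \ O → Equiv.swap a c v = v := by
    intro v hv
    refine Equiv.swap_apply_of_ne_of_ne ?_ ?_ <;> rintro rfl <;> contradiction
  rcases lt_trichotomy (i : ℕ) j with hij | hij | hij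
  · have hi : (i : ℕ) < d := by omega
    have hne : (⟨i, hi⟩ : Fin d) ≠ j := by rintro rfl; simp at hij
    rw [stage_twist_of_le a c hij.le, shuffling_of_lt _ _ hi, shuffling_of_lt _ _ hi,
      twist_of_ne hne]
  · have hi : (i : ℕ) < d := by omega
    have hj : (⟨i, hi⟩ : Fin d) = j := Fin.ext hij
    rw [stage_twist_of_le a c hij.le, shuffling_of_lt _ _ hi, shuffling_of_lt _ _ hi, hj]
    split_ifs with h
    · rfl
    · have h' : (stage g i).symm x ∉ nest n d l \ O := fun hx => h ⟨by omega, hx⟩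
      rw [hij] at h'
      have := hfix _ h'
      unfold twist
      rw [Function.update_self, Equiv.trans_apply]
      conv_lhs => rw [← (stage g j).apply_symm_apply x]
      rw [(stage g j).injective.swap_apply, this, Equiv.apply_symm_apply]
  · rw [stage_twist_of_gt a c i hij, Equiv.symm_trans_apply, Equiv.symm_swap]
    simp only [hswap]
    split_ifs with h
    · rfl
    · have h' : (stage g i).symm x ∉ nest n d l \ O := fun hx => h ⟨by omega, hx⟩
      by_cases hi : (i : ℕ) < d
      · rw [shuffling_of_lt _ _ hi, shuffling_of_lt _ _ hi,
          twist_of_ne (by rintro rfl; simp at hij)]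
      · have hid : (i : ℕ) = d := by omega
        rw [hid] at h' hij
        rw [shuffling_of_not_lt _ _ hi, shuffling_of_not_lt _ _ hi, stage_twist_of_gt a c d hij,
          Equiv.symm_trans_apply, Equiv.symm_swap, hfix _ h']

/-- Only the last function depends on the Simon function, and since `l ≤ d` every padded string lies
in `nest n d l`, so it is hidden unless it is open. -/
theorem blockedOracle_congr {f f' : Bits n → Bits n}
    (g : Fin d → Equiv.Perm (Bits (wordLen n d))) {l : ℕ} (hl : l ≤ d)
    {O : Finset (Bits (wordLen n d))} (h : ∀ x, pad d x ∈ O → f' x = f x) :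
    blockedOracle f' g l O = blockedOracle f g l O := by
  funext i x
  unfold blockedOracle
  split_ifs with hb
  · rfl
  · by_cases hi : (i : ℕ) < d
    · rw [shuffling_of_lt _ _ hi, shuffling_of_lt _ _ hi]
    · have hid : (i : ℕ) = d := by omega
      rw [shuffling_of_not_lt _ _ hi, shuffling_of_not_lt _ _ hi]
      split_ifs with hp
      · rw [h]
        by_contra hO
        refine hb ⟨by omega, Finset.mem_sdiff.2 ⟨?_, ?_⟩⟩
        · rw [hid, ← hp]; exact pad_mem_nest hl _
        · rw [hid, ← hp]; exact hO
      · rfl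

/-! ### Query weight carried by the path of a word. -/

section Load

variable {w : ℕ} (θ : ℝ) (Q : ParallelQuery n d w) (φ : Bits w → ℂ)
  (e : ℕ → Equiv.Perm (Bits (wordLen n d))) (l : ℕ)

open Classical in
/-- The words of `nest n d l` whose path is queried with a weight of at least `θ` at some level. -/
def heavySet : Finset (Bits (wordLen n d)) :=
  (nest n d l).filter fun v => ∃ i ∈ Icc l d, θ ≤ Q.weight φ i (e i v)

/-- The weight with which the path of a word is queried from level `l` on, in units of `θ`,
truncated at `1`. -/
def load (v : Bits (wordLen n d)) : ℝ := min 1 ((∑ i ∈ Icc l d, Q.weight φ i (e i v)) / θ)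

variable {θ}

theorem load_le_one (v : Bits (wordLen n d)) : load θ Q φ e l v ≤ 1 := min_le_left _ _

theorem load_nonneg (hθ : 0 < θ) (v : Bits (wordLen n d)) : 0 ≤ load θ Q φ e l v :=
  le_min zero_le_one (div_nonneg (Finset.sum_nonneg fun _ _ => Q.weight_nonneg _ _ _) hθ.le)

theorem load_eq_one (hθ : 0 < θ) {v : Bits (wordLen n d)} (hv : v ∈ heavySet θ Q φ e l) :
    load θ Q φ e l v = 1 := by
  obtain ⟨i, hi, h⟩ := (Finset.mem_filter.1 hv).2
  refine min_eq_left ((one_le_div hθ).2 (h.trans ?_))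
  exact Finset.single_le_sum (f := fun i => Q.weight φ i (e i v))
    (fun _ _ => Q.weight_nonneg _ _ _) hi

/-- A word that is not heavy has weight below `θ` at each of at most `d` levels. The factor `d` is
needed only where the load is truncated. -/
theorem sum_weight_le_load (hθ : 0 < θ) (hd : 1 ≤ d) (hl : 1 ≤ l) {v : Bits (wordLen n d)}
    (hv : v ∈ nest n d l) (hv' : v ∉ heavySet θ Q φ e l) :
    ∑ i ∈ Icc l d, Q.weight φ i (e i v) ≤ d * θ * load θ Q φ e l v := by
  have hd' : (1 : ℝ) ≤ d := by exact_mod_cast hd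
  unfold load
  rcases le_total 1 ((∑ i ∈ Icc l d, Q.weight φ i (e i v)) / θ) with h | h
  · rw [min_eq_left h, mul_one]
    have hlt : ∀ i ∈ Icc l d, Q.weight φ i (e i v) ≤ θ := by
      intro i hi
      by_contra! hlt
      exact hv' (Finset.mem_filter.2 ⟨hv, i, hi, hlt.le⟩)
    refine (Finset.sum_le_card_nsmul _ _ _ hlt).trans ?_
    rw [nsmul_eq_mul]
    refine mul_le_mul_of_nonneg_right ?_ hθ.le
    rw [Nat.card_Icc]
    exact_mod_cast (by omega : d + 1 - l ≤ d)
  · rw [min_eq_right h, mul_assoc, mul_div_cancel₀ _ hθ.ne']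
    exact le_mul_of_one_le_left (Finset.sum_nonneg fun _ _ => Q.weight_nonneg _ _ _) hd'

theorem sum_sum_weight_eq (V : Finset (Bits (wordLen n d))) :
    ∑ p ∈ (Icc l d ×ˢ V).image (fun p => (p.1, e p.1 p.2)), Q.weight φ p.1 p.2
      = ∑ v ∈ V, ∑ i ∈ Icc l d, Q.weight φ i (e i v) := by
  rw [Finset.sum_image, Finset.sum_product_right]
  rintro ⟨i, v⟩ - ⟨i', v'⟩ - h
  simp only [Prod.mk.injEq] at h
  obtain ⟨rfl, h⟩ := h
  rw [(e i).injective h]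

theorem sum_load_le (hθ : 0 < θ) (V : Finset (Bits (wordLen n d))) :
    ∑ v ∈ V, load θ Q φ e l v ≤ Q.count * l2 φ ^ 2 / θ := by
  calc ∑ v ∈ V, load θ Q φ e l v ≤ ∑ v ∈ V, (∑ i ∈ Icc l d, Q.weight φ i (e i v)) / θ :=
        Finset.sum_le_sum fun _ _ => min_le_right _ _
    _ = (∑ v ∈ V, ∑ i ∈ Icc l d, Q.weight φ i (e i v)) / θ := by rw [Finset.sum_div]
    _ ≤ _ := by
        rw [← sum_sum_weight_eq]
        exact div_le_div_of_nonneg_right (Q.sum_weight_le _ _) hθ.le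

end Load

/-! ### The true run and the hybrid run of a circuit. -/

namespace QCircuit

variable (C : QCircuit n d)

/-- The state after `j` rounds of queries. -/
def partialState (F : OracleFn n d) : ℕ → Bits C.width → ℂ
  | 0 => (C.layer 0).toMatrix.mulVec (Pi.single C.input 1)
  | j + 1 => if h : j < d then (C.layer (Fin.succ ⟨j, h⟩)).toMatrix.mulVec
      (((C.parallel ⟨j, h⟩).toMatrix F).mulVec (partialState F j)) else partialState F j

theorem partialState_succ (F : OracleFn n d) (j : Fin d) :
    C.partialState F (j + 1) = (C.layer j.succ).toMatrix.mulVec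
      (((C.parallel j).toMatrix F).mulVec (C.partialState F j)) := by
  rw [partialState, dif_pos j.2]

theorem state_eq (F : OracleFn n d) : C.state F = C.partialState F d :=
  foldl_finRange_eq d (fun ψ k => (C.layer k.succ).toMatrix.mulVec
    (((C.parallel k).toMatrix F).mulVec ψ)) (C.partialState F) fun j => C.partialState_succ F j

theorem l2_initial : l2 ((C.layer 0).toMatrix.mulVec (Pi.single C.input 1)) = 1 := by
  rw [l2_mulVec (C.layer 0).conjTranspose_mul_self]
  unfold l2
  rw [PiLp.toLp_single, PiLp.norm_single, norm_one]

theorem l2_partialState (F : OracleFn n d) : ∀ j, l2 (C.partialState F j) = 1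
  | 0 => C.l2_initial
  | j + 1 => by
    rw [partialState]
    split_ifs with h
    · rw [l2_mulVec (Layer.conjTranspose_mul_self _), ParallelQuery.l2_mulVec_eq,
        l2_partialState F j]
    · exact l2_partialState F j

variable (θ : ℝ) (g : Fin d → Equiv.Perm (Bits (wordLen n d))) (f : Bits n → Bits n)

/-- The run of a circuit in which the `j`-th round of queries is answered by the oracle that hides
the paths through `nest n d j`, apart from those that were opened because they were queried with a
large weight: the state and the set of open words after `j` rounds. -/
def hybrid : ℕ → (Bits C.width → ℂ) × Finset (Bits (wordLen n d))
  | 0 => ((C.layer 0).toMatrix.mulVec (Pi.single C.input 1), ∅)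
  | j + 1 => if h : j < d then
      -- Heavy words are opened before the round is answered, so every word that remains hidden is
      -- light.
      let O := (hybrid j).2 ∪ heavySet θ (C.parallel ⟨j, h⟩) (hybrid j).1 (stage g) (j + 1)
      ((C.layer (Fin.succ ⟨j, h⟩)).toMatrix.mulVec
        (((C.parallel ⟨j, h⟩).toMatrix (blockedOracle f g (j + 1) O)).mulVec (hybrid j).1), O)
    else hybrid j

theorem hybrid_succ_snd (j : Fin d) : (C.hybrid θ g f (j + 1)).2 = (C.hybrid θ g f j).2 ∪
    heavySet θ (C.parallel j) (C.hybrid θ g f j).1 (stage g) (j + 1) := by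
  rw [hybrid, dif_pos j.2]

theorem hybrid_succ_fst (j : Fin d) : (C.hybrid θ g f (j + 1)).1 =
    (C.layer j.succ).toMatrix.mulVec (((C.parallel j).toMatrix
      (blockedOracle f g (j + 1) (C.hybrid θ g f (j + 1)).2)).mulVec (C.hybrid θ g f j).1) := by
  rw [hybrid, dif_pos j.2]

theorem l2_hybrid : ∀ j, l2 (C.hybrid θ g f j).1 = 1
  | 0 => C.l2_initial
  | j + 1 => by
    by_cases h : j < d
    · rw [C.hybrid_succ_fst θ g f ⟨j, h⟩, l2_mulVec (Layer.conjTranspose_mul_self _),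
        ParallelQuery.l2_mulVec_eq]
      exact l2_hybrid j
    · rw [hybrid, dif_neg h]
      exact l2_hybrid j

theorem hybrid_snd_mono {i j : ℕ} (h : i ≤ j) :
    (C.hybrid θ g f i).2 ⊆ (C.hybrid θ g f j).2 := by
  induction j, h using Nat.le_induction with
  | base => exact subset_rfl
  | succ j _ ih =>
    refine ih.trans ?_
    by_cases h : j < d
    · rw [C.hybrid_succ_snd θ g f ⟨j, h⟩]; exact Finset.subset_union_left
    · rw [hybrid, dif_neg h]

/-- The total load of the hidden paths in the `j`-th round of queries. -/
def totalLoad (j : Fin d) : ℝ := ∑ v ∈ nest n d (j + 1) \ (C.hybrid θ g f j).2,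
  load θ (C.parallel j) (C.hybrid θ g f j).1 (stage g) (j + 1) v

/-- In some round of queries the total load of the hidden paths exceeds `k`. -/
def Overloaded (k : ℕ) : Prop := ∃ j, (k : ℝ) < C.totalLoad θ g f j

variable {θ}

/-- The total load is taken before the new words are opened, and each of these contributes exactly
1. -/
theorem card_heavySet_sdiff_le (hθ : 0 < θ) (j : Fin d) :
    ((heavySet θ (C.parallel j) (C.hybrid θ g f j).1 (stage g) (j + 1) \
      (C.hybrid θ g f j).2).card : ℝ) ≤ C.totalLoad θ g f j := by
  set H := heavySet θ (C.parallel j) (C.hybrid θ g f j).1 (stage g) (j + 1) with hH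
  calc ((H \ (C.hybrid θ g f j).2).card : ℝ) = ∑ v ∈ H \ (C.hybrid θ g f j).2,
        load θ (C.parallel j) (C.hybrid θ g f j).1 (stage g) (j + 1) v := by
        rw [Finset.sum_congr rfl fun v hv => load_eq_one _ _ _ _ hθ (Finset.mem_sdiff.1 hv).1]
        simp [hH]
    _ ≤ _ := Finset.sum_le_sum_of_subset_of_nonneg
        (Finset.sdiff_subset_sdiff (Finset.filter_subset _ _) subset_rfl)
        fun v _ _ => load_nonneg _ _ _ _ hθ v

theorem card_hybrid_snd_le (hθ : 0 < θ) {k : ℕ} : ∀ j : ℕ, j ≤ d →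
    (∀ i : Fin d, (i : ℕ) < j → C.totalLoad θ g f i ≤ k) → (C.hybrid θ g f j).2.card ≤ j * k
  | 0, _, _ => by simp [hybrid]
  | j + 1, hj, h => by
    have ih := card_hybrid_snd_le hθ j (by omega) fun i hi => h i (by omega)
    have h1 := (C.card_heavySet_sdiff_le g f hθ ⟨j, hj⟩).trans (h ⟨j, hj⟩ (by simp))
    rw [C.hybrid_succ_snd θ g f ⟨j, hj⟩, ← Finset.union_sdiff_self_eq_union, add_mul, one_mul]
    exact (Finset.card_union_le _ _).trans (add_le_add ih (by exact_mod_cast h1))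

/-- Each round adds one error, since the unitaries preserve the distance accumulated so far. Light
hidden words carry weight at most `d * θ * k` altogether, and `l2_mulVec_sub_le` bounds the square
of the error by four times that. -/
theorem l2_partialState_sub_hybrid_le (hθ : 0 < θ) (hd : 1 ≤ d) {k : ℕ}
    (h : ∀ i : Fin d, C.totalLoad θ g f i ≤ k) : ∀ j : ℕ, j ≤ d →
    l2 (C.partialState (shuffling f g) j - (C.hybrid θ g f j).1)
      ≤ j * (2 * Real.sqrt (d * θ * k))
  | 0, _ => by simp [hybrid, partialState, l2]
  | j + 1, hj => by
    have ih := l2_partialState_sub_hybrid_le hθ hd h j (by omega)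
    rw [C.partialState_succ _ ⟨j, hj⟩, C.hybrid_succ_fst θ g f ⟨j, hj⟩, ← Matrix.mulVec_sub,
      l2_mulVec (Layer.conjTranspose_mul_self _)]
    refine (l2_sub_le_add _ (((C.parallel ⟨j, hj⟩).toMatrix (shuffling f g)).mulVec
      (C.hybrid θ g f j).1) _).trans ?_
    rw [ParallelQuery.l2_mulVec_sub_mulVec_eq]
    push_cast
    rw [add_mul, one_mul]
    refine add_le_add ih (abs_le_of_sq_le_sq' ?_ (by positivity)).2
    set O := (C.hybrid θ g f (j + 1)).2 with hO
    set φ := (C.hybrid θ g f j).1 with hφ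
    refine ((C.parallel ⟨j, hj⟩).l2_mulVec_sub_le _ _ φ ((Icc (j + 1) d ×ˢ
      (nest n d (j + 1) \ O)).image fun p => (p.1, stage g p.1 p.2)) ?_).trans ?_
    · intro i u hne
      unfold blockedOracle at hne
      split_ifs at hne with hb
      · refine Finset.mem_image.2 ⟨(i, (stage g i).symm u), ?_, by simp⟩
        exact Finset.mem_product.2 ⟨Finset.mem_Icc.2 ⟨hb.1, by omega⟩, hb.2⟩
      · exact absurd rfl hne
    · rw [sum_sum_weight_eq, mul_pow, Real.sq_sqrt (by positivity)]
      have hsub : heavySet θ (C.parallel ⟨j, hj⟩) φ (stage g) (j + 1) ⊆ O := by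
        rw [hO, C.hybrid_succ_snd θ g f ⟨j, hj⟩]; exact Finset.subset_union_right
      have : ∑ v ∈ nest n d (j + 1) \ O, ∑ i ∈ Icc (j + 1) d,
          (C.parallel ⟨j, hj⟩).weight φ i (stage g i v) ≤ d * θ * k := by
        calc _ ≤ ∑ v ∈ nest n d (j + 1) \ O, d * θ *
              load θ (C.parallel ⟨j, hj⟩) φ (stage g) (j + 1) v := by
              refine Finset.sum_le_sum fun v hv => ?_
              rw [Finset.mem_sdiff] at hv
              exact sum_weight_le_load _ _ _ _ hθ hd (by omega) hv.1 fun h => hv.2 (hsub h)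
          _ ≤ d * θ * C.totalLoad θ g f ⟨j, hj⟩ := by
              rw [← Finset.mul_sum]
              refine mul_le_mul_of_nonneg_left ?_ (by positivity)
              refine Finset.sum_le_sum_of_subset_of_nonneg (Finset.sdiff_subset_sdiff subset_rfl
                (C.hybrid_snd_mono θ g f (Nat.le_succ j))) fun v _ _ => load_nonneg _ _ _ _ hθ v
          _ ≤ _ := mul_le_mul_of_nonneg_left (h _) (by positivity)
      linarith

/-- The distribution of the outcomes of a circuit is close to that of its hybrid run. -/
theorem sum_abs_outcomeProb_sub_le (hθ : 0 < θ) (hd : 1 ≤ d) {k : ℕ}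
    (h : ¬C.Overloaded θ g f k) :
    ∑ z, |C.outcomeProb (shuffling f g) z - ‖(C.hybrid θ g f d).1 z‖ ^ 2|
      ≤ 4 * d * Real.sqrt (d * θ * k) := by
  unfold Overloaded at h
  push Not at h
  unfold outcomeProb
  rw [state_eq]
  refine (sum_abs_sub_norm_sq_le _ _).trans ?_
  rw [l2_partialState, l2_hybrid]
  have := C.l2_partialState_sub_hybrid_le g f hθ hd h d le_rfl
  linarith

theorem sum_outcomeProb (F : OracleFn n d) : ∑ z, C.outcomeProb F z = 1 := by
  unfold outcomeProb
  rw [← l2_sq, state_eq, l2_partialState, one_pow]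

theorem sum_norm_sq_hybrid (j : ℕ) : ∑ z, ‖(C.hybrid θ g f j).1 z‖ ^ 2 = 1 := by
  rw [← l2_sq, l2_hybrid, one_pow]

end QCircuit

end Hybrid

/-! ### Exponential tail for the load, over random permutations. -/

section Tail

variable {n d : ℕ}

theorem load_twist {w : ℕ} (θ : ℝ) (Q : ParallelQuery n d w) (φ : Bits w → ℂ)
    (g : Fin d → Equiv.Perm (Bits (wordLen n d))) (j : Fin d) (a c v : Bits (wordLen n d)) :
    load θ Q φ (stage (twist g j a c)) (j + 1) v
      = load θ Q φ (stage g) (j + 1) (Equiv.swap a c v) := by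
  unfold load
  congr 2
  refine Finset.sum_congr rfl fun i hi => ?_
  rw [stage_twist_of_gt a c i (Finset.mem_Icc.1 hi).1]; rfl

namespace QCircuit

variable (C : QCircuit n d) (θ : ℝ) (f : Bits n → Bits n)

/-- The first `j` rounds of a hybrid run do not see how the `j`-th permutation acts on the hidden
words. -/
theorem hybrid_twist (g : Fin d → Equiv.Perm (Bits (wordLen n d))) (j : Fin d)
    {a c : Bits (wordLen n d)} (ha : a ∈ nest n d j \ (C.hybrid θ g f j).2)
    (hc : c ∈ nest n d j \ (C.hybrid θ g f j).2) :
    ∀ i : ℕ, i ≤ j → C.hybrid θ (twist g j a c) f i = C.hybrid θ g f i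
  | 0, _ => rfl
  | i + 1, hi => by
    have ih := hybrid_twist g j ha hc i (by omega)
    have hid : i < d := by omega
    have hO := C.hybrid_snd_mono θ g f hi
    have hmem : ∀ v ∈ nest n d j \ (C.hybrid θ g f j).2,
        v ∈ nest n d (i + 1) \ (C.hybrid θ g f (i + 1)).2 := fun v hv =>
      Finset.sdiff_subset_sdiff (nest_anti n d hi) hO hv
    have ha' := hmem a ha
    have hc' := hmem c hc
    have hsucc := C.hybrid_succ_snd θ g f ⟨i, hid⟩
    -- A word hidden after this round was not heavy in it, so exchanging the paths of `a` and `c`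
    -- exchanges light words with light words.
    have hnot : ∀ v ∈ nest n d (i + 1) \ (C.hybrid θ g f (i + 1)).2, ∀ i' ∈ Icc (i + 1) d,
        ¬ θ ≤ (C.parallel ⟨i, hid⟩).weight (C.hybrid θ g f i).1 i' (stage g i' v) := by
      intro v hv i' hi' hle
      rw [Finset.mem_sdiff] at hv
      refine hv.2 ?_
      rw [hsucc]
      exact Finset.mem_union_right _ (Finset.mem_filter.2 ⟨hv.1, i', hi', hle⟩)
    have hheavy : heavySet θ (C.parallel ⟨i, hid⟩) (C.hybrid θ g f i).1
        (stage (twist g j a c)) (i + 1) = heavySet θ (C.parallel ⟨i, hid⟩) (C.hybrid θ g f i).1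
        (stage g) (i + 1) := by
      refine Finset.filter_congr fun v _ => ?_
      refine exists_congr fun i' => and_congr_right fun hi' => ?_
      rcases le_or_gt i' (j : ℕ) with h | h
      · rw [stage_twist_of_le a c h]
      · rw [stage_twist_of_gt a c i' h, Equiv.trans_apply]
        rcases eq_or_ne v a with rfl | hva
        · rw [Equiv.swap_apply_left]
          exact iff_of_false (hnot c hc' i' hi') (hnot v ha' i' hi')
        rcases eq_or_ne v c with rfl | hvc
        · rw [Equiv.swap_apply_right]
          exact iff_of_false (hnot a ha' i' hi') (hnot v hc' i' hi')
        · rw [Equiv.swap_apply_of_ne_of_ne hva hvc]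
    have h2 : (C.hybrid θ (twist g j a c) f (i + 1)).2 = (C.hybrid θ g f (i + 1)).2 := by
      rw [C.hybrid_succ_snd θ _ f ⟨i, hid⟩, hsucc]
      simp only [ih, hheavy]
    refine Prod.ext ?_ h2
    rw [C.hybrid_succ_fst θ _ f ⟨i, hid⟩, C.hybrid_succ_fst θ g f ⟨i, hid⟩]
    simp only [h2, ih]
    rw [blockedOracle_twist f g hi ha' hc']

open Classical in
-- Markov's inequality for `2 ^ load`. The permutations are grouped by the set of open words. Within
-- a class, transpositions of hidden words of `nest n d j` act, and `nest n d (j + 1)` is a sparse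
-- part of it.
theorem card_lt_totalLoad_le (hn : 2 ≤ n) {a : ℕ} (ha : 1 ≤ a) (j : Fin d)
    (hcount : (C.parallel j).count ≤ a) {D : ℕ} (hD : 4 * D ≤ 2 ^ n) (k : ℕ) :
    ((univ.filter fun g => (C.hybrid (2 * a / 2 ^ n) g f j).2.card ≤ D ∧
      (k : ℝ) < C.totalLoad (2 * a / 2 ^ n) g f j).card : ℝ) * 2 ^ k
      ≤ 3 * Fintype.card (Fin d → Equiv.Perm (Bits (wordLen n d))) := by
  set θ : ℝ := 2 * a / 2 ^ n with hθdef
  have ha' : (1 : ℝ) ≤ a := by exact_mod_cast ha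
  have hθ : 0 < θ := by positivity
  set G := univ.filter fun g => (C.hybrid θ g f j).2.card ≤ D with hG
  let y : (Fin d → Equiv.Perm (Bits (wordLen n d))) → Bits (wordLen n d) → ℝ := fun g v =>
    load θ (C.parallel j) (C.hybrid θ g f j).1 (stage g) (j + 1) v
  let P : (Fin d → Equiv.Perm (Bits (wordLen n d))) → ℝ := fun g =>
    ∏ v ∈ nest n d (j + 1) \ (C.hybrid θ g f j).2, (1 + y g v)
  have hP0 : ∀ g, 0 ≤ P g := fun g => Finset.prod_nonneg fun v _ =>
    add_nonneg zero_le_one (load_nonneg _ _ _ _ hθ v)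
  have hdj : d + 2 - (j : ℕ) = (d + 2 - (j + 1)) + 1 := by have := j.2; omega
  have hcard : (nest n d j).card = 2 ^ n * (nest n d (j + 1)).card := by
    rw [card_nest, card_nest, hdj, add_mul, one_mul, pow_add, mul_comm]
  have hbig : 2 ^ n ≤ (nest n d (j + 1)).card := by
    rw [card_nest]
    exact Nat.pow_le_pow_right (by norm_num) (Nat.le_mul_of_pos_left _ (by have := j.2; omega))
  set M : ℝ := ((nest n d (j + 1)).card : ℝ) with hM
  have hM0 : 0 < M := lt_of_lt_of_le (by positivity : (0 : ℝ) < 2 ^ n) (by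
    rw [hM]; exact_mod_cast hbig)
  have hMn : (2 : ℝ) ^ n ≤ M := by rw [hM]; exact_mod_cast hbig
  have h4 : (4 : ℝ) ≤ 2 ^ n := by
    calc (4 : ℝ) = 2 ^ 2 := by norm_num
      _ ≤ 2 ^ n := pow_le_pow_right₀ (by norm_num) hn
  have hD' : 4 * (D : ℝ) ≤ 2 ^ n := by exact_mod_cast hD
  -- the average over the permutations for which a given set of words is open
  have hclass : ∀ O : Finset (Bits (wordLen n d)), O.card ≤ D →
      ∑ g ∈ univ.filter (fun g => (C.hybrid θ g f j).2 = O), P g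
        ≤ (univ.filter fun g => (C.hybrid θ g f j).2 = O).card * 3 := by
    intro O hO
    have hO' : (O.card : ℝ) ≤ D := by exact_mod_cast hO
    -- The total load is at most `a / θ = 2 ^ n / 2`, and at least `2 ^ n * M / 2` words are left to
    -- swap with. The ratio is `1 / M`, and at most `M` factors `1 + 1 / M` give at most `e ≤ 3`.
    have key := sum_prod_one_add_le (univ.filter fun g => (C.hybrid θ g f j).2 = O)
      (nest n d j \ O) (fun a c g => twist g j a c) ?_ (fun a c g => twist_twist j a c) y
      (fun g v => load_nonneg _ _ _ _ hθ v) ?_ (2 ^ n / 2) ?_ (m := 2 ^ n * M / 2)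
      (by positivity) (nest n d (j + 1) \ O)
      (Finset.sdiff_subset_sdiff (nest_anti n d (Nat.le_succ _)) subset_rfl) ?_
    · refine le_trans (le_of_eq ?_) (key.trans (mul_le_mul_of_nonneg_left ?_ (by positivity)))
      · refine Finset.sum_congr rfl fun g hg => ?_
        simp only [P, (Finset.mem_filter.1 hg).2]
      · have hx : (2 : ℝ) ^ n / 2 / (2 ^ n * M / 2) = 1 / M := by field_simp
        rw [hx]
        calc (1 + 1 / M) ^ (nest n d (j + 1) \ O).card
            ≤ (Real.exp (1 / M)) ^ (nest n d (j + 1) \ O).card := by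
              refine pow_le_pow_left₀ (by positivity) ?_ _
              rw [add_comm]; exact Real.add_one_le_exp _
          _ = Real.exp ((nest n d (j + 1) \ O).card * (1 / M)) := (Real.exp_nat_mul _ _).symm
          _ ≤ Real.exp 1 := by
              refine Real.exp_le_exp.2 ?_
              rw [mul_one_div, div_le_one hM0, hM]
              exact_mod_cast Finset.card_le_card Finset.sdiff_subset
          _ ≤ 3 := Real.exp_one_lt_d9.le.trans (by norm_num)
    · intro a ha c hc g hg
      rw [Finset.mem_filter] at hg ⊢
      obtain rfl := hg.2
      exact ⟨mem_univ _, by rw [C.hybrid_twist θ f g j ha hc j le_rfl]⟩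
    · intro a ha c hc g hg v
      obtain rfl := (Finset.mem_filter.1 hg).2
      simp only [y]
      rw [C.hybrid_twist θ f g j ha hc j le_rfl, load_twist]
    · intro g _
      refine (sum_load_le _ _ _ _ hθ _).trans ?_
      rw [C.l2_hybrid, one_pow, mul_one, div_le_iff₀ hθ, hθdef]
      field_simp
      exact_mod_cast hcount
    -- From `2 ^ n * M` words, the at most `M` words of the smaller set and the at most `D` open
    -- ones are lost, each at most a quarter because `4 ≤ 2 ^ n` and `4 * D ≤ 2 ^ n`.
    · have e1 : ((nest n d (j + 1) \ O).card : ℝ) ≤ M := by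
        rw [hM]; exact_mod_cast Finset.card_le_card Finset.sdiff_subset
      have e2 : (2 : ℝ) ^ n * M ≤ (nest n d j \ O).card + O.card := by
        have := Finset.card_le_card_sdiff_add_card (s := nest n d j) (t := O)
        rw [hcard] at this
        rw [hM]
        exact_mod_cast this
      nlinarith
  have hsum : ∑ g ∈ G, P g ≤ 3 * Fintype.card (Fin d → Equiv.Perm (Bits (wordLen n d))) := by
    rw [← Finset.sum_fiberwise_of_maps_to (t := univ) (g := fun g => (C.hybrid θ g f j).2)
      fun _ _ => mem_univ _]
    calc _ ≤ ∑ O : Finset (Bits (wordLen n d)),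
          ((univ.filter fun g => (C.hybrid θ g f j).2 = O).card : ℝ) * 3 := by
          refine Finset.sum_le_sum fun O _ => ?_
          by_cases hO : O.card ≤ D
          · refine le_trans ?_ (hclass O hO)
            refine Finset.sum_le_sum_of_subset_of_nonneg ?_ fun g _ _ => hP0 g
            exact Finset.filter_subset_filter _ (Finset.subset_univ _)
          · rw [Finset.sum_eq_zero]
            · positivity
            · intro g hg
              rw [hG, Finset.mem_filter, Finset.mem_filter] at hg
              exact absurd (hg.2 ▸ hg.1.2) hO
      _ = _ := by
          rw [← Finset.sum_mul, mul_comm]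
          congr 1
          rw [← Nat.cast_sum, ← Finset.card_eq_sum_card_fiberwise fun _ _ => mem_univ _,
            Finset.card_univ]
  refine le_trans ?_ hsum
  rw [← nsmul_eq_mul, ← Finset.sum_const]
  refine (Finset.sum_le_sum fun g hg => ?_).trans
    (Finset.sum_le_sum_of_subset_of_nonneg (t := G) ?_ fun g _ _ => hP0 g)
  · have hk := (Finset.mem_filter.1 hg).2.2
    refine le_trans ?_ (two_rpow_sum_le_prod _ _ (fun v => load_nonneg _ _ _ _ hθ v)
      fun v => load_le_one _ _ _ _ v)
    rw [← Real.rpow_natCast]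
    exact Real.rpow_le_rpow_of_exponent_le (by norm_num) hk.le
  · intro g hg
    rw [Finset.mem_filter] at hg
    exact Finset.mem_filter.2 ⟨mem_univ _, hg.2.1⟩

open Classical in
/-- Few tuples of permutations overload a given circuit. -/
theorem card_overloaded_le (hn : 2 ≤ n) {a : ℕ} (ha : 1 ≤ a) (hw : C.width ≤ a) {k : ℕ}
    (hk : 4 * (d * k) ≤ 2 ^ n) :
    ((univ.filter fun g => C.Overloaded (2 * a / 2 ^ n) g f k).card : ℝ) * 2 ^ k
      ≤ 3 * d * Fintype.card (Fin d → Equiv.Perm (Bits (wordLen n d))) := by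
  have ha' : (1 : ℝ) ≤ a := by exact_mod_cast ha
  have hθ : (0 : ℝ) < 2 * a / 2 ^ n := by positivity
  have hsub : (univ.filter fun g => C.Overloaded (2 * a / 2 ^ n) g f k) ⊆
      univ.biUnion fun j : Fin d => univ.filter fun g =>
        (C.hybrid (2 * a / 2 ^ n) g f j).2.card ≤ d * k ∧
          (k : ℝ) < C.totalLoad (2 * a / 2 ^ n) g f j := by
    intro g hg
    -- Take the first overloaded round: the loads before it are at most `k`, so at most `d * k`
    -- words are open when it starts.
    have hex : ∃ m : ℕ, ∃ h : m < d, (k : ℝ) < C.totalLoad (2 * a / 2 ^ n) g f ⟨m, h⟩ := by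
      obtain ⟨j, hj⟩ := (Finset.mem_filter.1 hg).2
      exact ⟨j, j.2, hj⟩
    obtain ⟨hm, hload⟩ := Nat.find_spec hex
    refine Finset.mem_biUnion.2 ⟨⟨_, hm⟩, mem_univ _, Finset.mem_filter.2 ⟨mem_univ _, ?_, hload⟩⟩
    refine (C.card_hybrid_snd_le g f hθ _ hm.le fun i hi => ?_).trans
      (Nat.mul_le_mul_right _ hm.le)
    by_contra! hlt
    exact Nat.find_min hex hi ⟨i.2, hlt⟩
  calc _ ≤ (∑ j : Fin d, ((univ.filter fun g =>
        (C.hybrid (2 * a / 2 ^ n) g f j).2.card ≤ d * k ∧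
          (k : ℝ) < C.totalLoad (2 * a / 2 ^ n) g f j).card : ℝ)) * 2 ^ k := by
        refine mul_le_mul_of_nonneg_right ?_ (by positivity)
        exact_mod_cast (Finset.card_le_card hsub).trans Finset.card_biUnion_le
    _ ≤ ∑ _j : Fin d, 3 * (Fintype.card (Fin d → Equiv.Perm (Bits (wordLen n d))) : ℝ) := by
        rw [Finset.sum_mul]
        refine Finset.sum_le_sum fun j _ => ?_
        exact C.card_lt_totalLoad_le f hn ha j ((C.parallel j).count_le.trans hw) hk k
    _ = _ := by rw [Finset.sum_const, Finset.card_univ, Fintype.card_fin, nsmul_eq_mul]; ring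

/-- A circuit that is too narrow for a single query is never overloaded. -/
theorem not_overloaded_of_width_lt (hn : 1 ≤ n) {θ : ℝ} (hθ : 0 < θ) (hw : C.width < d + 2)
    (g : Fin d → Equiv.Perm (Bits (wordLen n d))) (k : ℕ) : ¬C.Overloaded θ g f k := by
  rintro ⟨j, hj⟩
  have h := sum_load_le (C.parallel j) (C.hybrid θ g f j).1 (stage g) (j + 1) hθ
    (nest n d (j + 1) \ (C.hybrid θ g f j).2)
  rw [(C.parallel j).count_eq_zero hn hw, Nat.cast_zero, zero_mul, zero_div] at h
  exact absurd (hj.trans_le h) (not_lt.2 (Nat.cast_nonneg k))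

end QCircuit

end Tail

section Simon

variable {n : ℕ}

theorem Bits.add_self (x : Bits n) : x + x = 0 := funext fun _ => CharTwo.add_self_eq_zero _

/-! ### Finding the hidden shift with few queries to a Simon function -/

/-- Two functions agree on a finite set. -/
def Agree {α β : Type*} (X : Finset α) (f f₀ : α → β) : Prop := ∀ x ∈ X, f x = f₀ x

/-- On the functions that agree with `f₀` on `X`, the value `Φ f s` is the probability that a
randomized algorithm, which makes at most `K` further queries to `f`, outputs `s`. -/
inductive DecisionTree : ℕ → Finset (Bits n) → (Bits n → Bits n) →
    ((Bits n → Bits n) → Bits n → ℝ) → Prop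
  | leaf {K X f₀ Φ} (c : Bits n → ℝ) (h0 : ∀ s, 0 ≤ c s) (h1 : ∑ s, c s ≤ 1)
      (h : ∀ f, Agree X f f₀ → Φ f = c) : DecisionTree K X f₀ Φ
  | ask {K X f₀ Φ} (x : Bits n) (h : ∀ f, Agree X f f₀ → DecisionTree K (insert x X) f Φ) :
      DecisionTree (K + 1) X f₀ Φ
  -- The weights may depend on `f₀`, that is, on the values on `X`. This covers the measurement of a
  -- state computed from known values.
  | mix {K X f₀ Φ} {ι : Type} (t : Finset ι) (p : ι → ℝ)
      (Ψ : ι → (Bits n → Bits n) → Bits n → ℝ) (h0 : ∀ z ∈ t, 0 ≤ p z) (h1 : ∑ z ∈ t, p z ≤ 1)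
      (h : ∀ f, Agree X f f₀ → ∀ s, Φ f s = ∑ z ∈ t, p z * Ψ z f s)
      (hΨ : ∀ z ∈ t, DecisionTree K X f₀ (Ψ z)) : DecisionTree K X f₀ Φ

namespace DecisionTree

variable {K : ℕ} {X : Finset (Bits n)} {f₀ : Bits n → Bits n}
  {Φ : (Bits n → Bits n) → Bits n → ℝ}

theorem mono (h : DecisionTree K X f₀ Φ) {K' : ℕ} (hK : K ≤ K') : DecisionTree K' X f₀ Φ := by
  induction h generalizing K' with
  | leaf c h0 h1 h => exact leaf c h0 h1 h
  | ask x _ ih =>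
    obtain ⟨K'', rfl⟩ : ∃ K'', K' = K'' + 1 := ⟨K' - 1, by omega⟩
    exact ask x fun f hf => ih f hf (by omega)
  | mix t p Ψ h0 h1 h _ ih => exact mix t p Ψ h0 h1 h fun z hz => ih z hz hK

theorem mem_Icc (h : DecisionTree K X f₀ Φ) {f : Bits n → Bits n} (hf : Agree X f f₀)
    (s : Bits n) : Φ f s ∈ Set.Icc (0 : ℝ) 1 := by
  induction h with
  | leaf c h0 h1 h =>
    rw [h f hf]
    exact ⟨h0 s, (Finset.single_le_sum (fun s _ => h0 s) (mem_univ s)).trans h1⟩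
  | ask x _ ih => exact ih f hf fun _ _ => rfl
  | mix t p Ψ h0 h1 h _ ih =>
    rw [h f hf]
    refine ⟨Finset.sum_nonneg fun z hz => mul_nonneg (h0 z hz) (ih z hz hf).1, ?_⟩
    refine le_trans (Finset.sum_le_sum fun z hz => ?_) h1
    exact mul_le_of_le_one_right (h0 z hz) (ih z hz hf).2

theorem ask_set (Z : Finset (Bits n))
    (h : ∀ f, Agree X f f₀ → DecisionTree K (X ∪ Z) f Φ) : DecisionTree (K + Z.card) X f₀ Φ := by
  induction Z using Finset.induction_on generalizing X f₀ with
  | empty => simpa using h f₀ fun _ _ => rfl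
  | insert x Z hx ih =>
    rw [Finset.card_insert_of_notMem hx, ← add_assoc]
    refine ask x fun f hf => ih fun f' hf' => ?_
    have : insert x X ∪ Z = X ∪ insert x Z := by
      rw [Finset.insert_union, Finset.union_insert]
    rw [this]
    exact h f' fun y hy => (hf' y (Finset.mem_insert_of_mem hy)).trans (hf y hy)

open Classical in
/-- The nonzero shifts that do not relate two elements of `X`. -/
def shifts (X : Finset (Bits n)) : Finset (Bits n) :=
  univ.filter fun s => s ≠ 0 ∧ ∀ x ∈ X, x + s ∉ X

end DecisionTree

open Classical in
/-- The permutations `σ` for which `σ ∘ h` agrees with `f₀` on `X`. -/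
def permsAgree {α : Type*} [Fintype α] [DecidableEq α] (X : Finset α) (h f₀ : α → α) :
    Finset (Equiv.Perm α) :=
  univ.filter fun σ => Agree X (σ ∘ h) f₀

theorem mem_permsAgree {α : Type*} [Fintype α] [DecidableEq α] {X : Finset α} {h f₀ : α → α}
    {σ : Equiv.Perm α} : σ ∈ permsAgree X h f₀ ↔ Agree X (σ ∘ h) f₀ := by
  simp [permsAgree]

theorem agree_insert_iff {α : Type*} [DecidableEq α] {h f₀ : α → α} {X : Finset α} {x : α}
    (hx : x ∉ X) (v : α) (σ : Equiv.Perm α) : Agree (insert x X) (σ ∘ h) (Function.update f₀ x v) ↔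
      Agree X (σ ∘ h) f₀ ∧ σ (h x) = v := by
  constructor
  · intro H
    refine ⟨fun y hy => ?_, ?_⟩
    · rw [H y (Finset.mem_insert_of_mem hy), Function.update_of_ne]
      rintro rfl; exact hx hy
    · simpa using H x (Finset.mem_insert_self _ _)
  · rintro ⟨H, hv⟩ y hy
    rcases eq_or_ne y x with rfl | hyx
    · simpa using hv
    · rw [Function.update_of_ne hyx]
      exact H y (Finset.mem_of_mem_insert_of_ne hy hyx)

/-! ### Permutations with prescribed values. -/

section Perm

variable {α : Type*} [Fintype α] [DecidableEq α]

open Classical in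
/-- Permutations with prescribed values on a set are classified by the value at a further point. -/
theorem sum_perm_agree_eq {h f₀ : α → α} {X : Finset α} {x : α} (hx : x ∉ X)
    (hh : Set.InjOn h (insert x X : Finset α)) (Ψ : Equiv.Perm α → ℝ) :
    ∑ σ ∈ permsAgree X h f₀, Ψ σ = ∑ v ∈ univ \ X.image f₀,
      ∑ σ ∈ permsAgree (insert x X) h (Function.update f₀ x v), Ψ σ := by
  rw [← Finset.sum_fiberwise_of_maps_to (t := univ \ X.image f₀) (g := fun σ => σ (h x))]
  · refine Finset.sum_congr rfl fun v _ => ?_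
    congr 1
    ext σ
    rw [Finset.mem_filter, mem_permsAgree, mem_permsAgree, agree_insert_iff hx]
  · intro σ hσ
    refine Finset.mem_sdiff.2 ⟨mem_univ _, fun hmem => ?_⟩
    obtain ⟨y, hy, hyx⟩ := Finset.mem_image.1 hmem
    rw [← mem_permsAgree.1 hσ y hy] at hyx
    have := hh (Finset.mem_insert_of_mem hy) (Finset.mem_insert_self _ _) (σ.injective hyx)
    exact hx (this ▸ hy)

open Classical in
/-- The number of permutations with prescribed values at the points of a finite set. -/
theorem card_perm_agree (h : α → α) (X : Finset α) (hh : Set.InjOn h X) (f₀ : α → α)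
    (hf₀ : Set.InjOn f₀ X) : (permsAgree X h f₀).card
      = (Fintype.card α - X.card).factorial := by
  induction X using Finset.induction_on with
  | empty => simp [permsAgree, Agree, Finset.card_univ, Fintype.card_perm]
  | insert x X hx ih =>
    have ih := ih (hh.mono (by simp)) (hf₀.mono (by simp))
    have hfx : f₀ x ∉ X.image f₀ := by
      intro hmem
      obtain ⟨y, hy, hyx⟩ := Finset.mem_image.1 hmem
      have := hf₀ (Finset.mem_insert_of_mem hy) (Finset.mem_insert_self _ _) hyx
      exact hx (this ▸ hy)
    have hX : X.card < Fintype.card α :=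
      lt_of_lt_of_le (by rw [Finset.card_insert_of_notMem hx]; omega)
        (Finset.card_le_univ (insert x X))
    set c := (permsAgree (insert x X) h f₀).card with hc
    -- Exchanging the unused values `v` and `f₀ x` in the range is a bijection between the fibres.
    have hfib : ∀ v ∈ univ \ X.image f₀, (permsAgree (insert x X) h
        (Function.update f₀ x v)).card = c := by
      intro v hv
      have hv' := (Finset.mem_sdiff.1 hv).2
      have hswap : ∀ σ : Equiv.Perm α, Agree X (σ ∘ h) f₀ →
          Agree X (σ.trans (Equiv.swap v (f₀ x)) ∘ h) f₀ := by
        intro σ hσ y hy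
        have hy' : σ (h y) = f₀ y := hσ y hy
        have hmem := Finset.mem_image_of_mem f₀ hy
        rw [Function.comp_apply, Equiv.trans_apply, hy']
        exact Equiv.swap_apply_of_ne_of_ne (fun e => hv' (e ▸ hmem)) fun e => hfx (e ▸ hmem)
      have hfun : f₀ = Function.update f₀ x (f₀ x) := by simp
      rw [hc, hfun]
      simp only [Function.update_idem]
      refine Finset.card_nbij' (fun σ => σ.trans (Equiv.swap v (f₀ x)))
        (fun σ => σ.trans (Equiv.swap v (f₀ x))) ?_ ?_ ?_ ?_
      · intro σ hσ
        rw [Finset.mem_coe, mem_permsAgree, agree_insert_iff hx] at hσ ⊢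
        exact ⟨hswap σ hσ.1, by simp [hσ.2]⟩
      · intro σ hσ
        rw [Finset.mem_coe, mem_permsAgree, agree_insert_iff hx] at hσ ⊢
        exact ⟨hswap σ hσ.1, by simp [hσ.2]⟩
      · intro σ _; ext1 y; simp
      · intro σ _; ext1 y; simp
    have hsum := sum_perm_agree_eq (f₀ := f₀) hx hh fun _ => 1
    simp only [Finset.sum_const, nsmul_eq_mul, mul_one] at hsum
    rw [ih, Finset.sum_congr rfl fun v hv => by rw [hfib v hv], Finset.sum_const, nsmul_eq_mul,
      ← Finset.compl_eq_univ_sdiff, Finset.card_compl,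
      Finset.card_image_of_injOn (hf₀.mono (by simp))] at hsum
    have hsum' : (Fintype.card α - X.card).factorial = (Fintype.card α - X.card) * c := by
      exact_mod_cast hsum
    rw [Finset.card_insert_of_notMem hx]
    obtain ⟨m, hm⟩ : ∃ m, Fintype.card α - X.card = m + 1 := ⟨Fintype.card α - X.card - 1, by omega⟩
    rw [hm, Nat.factorial_succ] at hsum'
    rw [show Fintype.card α - (X.card + 1) = m by omega]
    exact (Nat.eq_of_mul_eq_mul_left (Nat.succ_pos m) hsum').symm

end Perm

theorem IsSimon.injOn {s : Bits n} {f : Bits n → Bits n} (h : IsSimon s f) {X : Finset (Bits n)}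
    (hX : s ∈ DecisionTree.shifts X) : Set.InjOn f X := by
  intro x hx y hy hxy
  rcases (h.2 x y).1 hxy with rfl | rfl
  · rfl
  · exact absurd hy ((Finset.mem_filter.1 hX).2.2 x hx)

open Classical in
/-- Few queries to a random function with a given Simon shift do not reveal the shift. -/
theorem DecisionTree.sum_le {K : ℕ} {X : Finset (Bits n)} {f₀ : Bits n → Bits n}
    {Φ : (Bits n → Bits n) → Bits n → ℝ} (h : DecisionTree K X f₀ Φ) (hf₀ : Set.InjOn f₀ X)
    (F : Bits n → Bits n → Bits n) (hF : ∀ s, s ≠ 0 → IsSimon s (F s)) :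
    ∑ s ∈ shifts X, ∑ σ ∈ permsAgree X (F s) f₀, Φ (σ ∘ F s) s
      ≤ (Fintype.card (Bits n) - X.card).factorial * (1 + K * (X.card + K)) := by
  -- The number of functions compatible with the answers is the same for each shift that is not
  -- excluded, so these shifts remain equally likely.
  have hcard : ∀ (X : Finset (Bits n)) (f₀ : Bits n → Bits n), Set.InjOn f₀ X → ∀ s ∈ shifts X,
      (permsAgree X (F s) f₀).card
        = (Fintype.card (Bits n) - X.card).factorial := fun X f₀ hf₀ s hs =>
    card_perm_agree _ _ ((hF s (Finset.mem_filter.1 hs).2.1).injOn hs) _ hf₀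
  induction h with
  | @leaf K X f₀ Φ c h0 h1 h =>
    calc _ = ∑ s ∈ shifts X, ((Fintype.card (Bits n) - X.card).factorial : ℝ) * c s := by
          refine Finset.sum_congr rfl fun s hs => ?_
          rw [← hcard X f₀ hf₀ s hs, ← nsmul_eq_mul, ← Finset.sum_const]
          exact Finset.sum_congr rfl fun σ hσ => by rw [h _ (mem_permsAgree.1 hσ)]
      _ ≤ (Fintype.card (Bits n) - X.card).factorial * 1 := by
          rw [← Finset.mul_sum]
          refine mul_le_mul_of_nonneg_left (le_trans ?_ h1) (by positivity)
          exact Finset.sum_le_sum_of_subset_of_nonneg (Finset.subset_univ _) fun s _ _ => h0 s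
      _ ≤ _ := by
          refine mul_le_mul_of_nonneg_left ?_ (by positivity)
          have : (0 : ℝ) ≤ K * (X.card + K) := by positivity
          linarith
  | @ask K X f₀ Φ x h ih =>
    by_cases hx : x ∈ X
    · have := ih f₀ (fun _ _ => rfl) (by rwa [Finset.insert_eq_of_mem hx])
      rw [Finset.insert_eq_of_mem hx] at this
      refine this.trans (mul_le_mul_of_nonneg_left ?_ (by positivity))
      push_cast
      nlinarith [(Nat.cast_nonneg K : (0 : ℝ) ≤ K), (Nat.cast_nonneg X.card : (0 : ℝ) ≤ X.card)]
    have htree : DecisionTree (K + 1) X f₀ Φ := .ask x h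
    have hXN : X.card < Fintype.card (Bits n) :=
      lt_of_lt_of_le (by rw [Finset.card_insert_of_notMem hx]; omega)
        (Finset.card_le_univ (insert x X))
    obtain ⟨m, hm⟩ : ∃ m, Fintype.card (Bits n) - X.card = m + 1 :=
      ⟨Fintype.card (Bits n) - X.card - 1, by omega⟩
    have hm' : Fintype.card (Bits n) - (insert x X).card = m := by
      rw [Finset.card_insert_of_notMem hx]; omega
    have hsub : shifts (insert x X) ⊆ shifts X := by
      intro s hs
      obtain ⟨-, hs0, hs⟩ := Finset.mem_filter.1 hs
      exact Finset.mem_filter.2 ⟨mem_univ _, hs0, fun y hy hmem =>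
        hs y (Finset.mem_insert_of_mem hy) (Finset.mem_insert_of_mem hmem)⟩
    -- The question `x` can exclude only shifts of the form `x + y` with `y ∈ X`.
    have hdiff : (shifts X \ shifts (insert x X)).card ≤ X.card := by
      refine (Finset.card_le_card (t := X.image (x + ·)) fun s hs => ?_).trans
        Finset.card_image_le
      obtain ⟨hsX, hs⟩ := Finset.mem_sdiff.1 hs
      obtain ⟨-, hs0, hsX⟩ := Finset.mem_filter.1 hsX
      simp only [shifts, Finset.mem_filter, mem_univ, true_and, not_and, not_forall,
        not_not] at hs
      obtain ⟨y, hy, hys⟩ := hs hs0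
      rw [Finset.mem_image]
      rcases Finset.mem_insert.1 hy with rfl | hyX
      · rcases Finset.mem_insert.1 hys with h | h
        · exact absurd (by simpa using h) hs0
        · exact ⟨y + s, h, by rw [← add_assoc, Bits.add_self, zero_add]⟩
      · rcases Finset.mem_insert.1 hys with h | h
        · refine ⟨y, hyX, ?_⟩
          rw [← h, add_comm y s, add_assoc, Bits.add_self, add_zero]
        · exact absurd h (hsX y hyX)
    rw [← Finset.sum_sdiff hsub]
    -- Newly excluded shifts are those that the question `x` reveals. Success is granted on them.
    have h1 : ∑ s ∈ shifts X \ shifts (insert x X),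
        ∑ σ ∈ permsAgree X (F s) f₀, Φ (σ ∘ F s) s
          ≤ X.card * (m + 1).factorial := by
      refine (Finset.sum_le_card_nsmul _ _ ((m + 1).factorial : ℝ) fun s hs => ?_).trans ?_
      · refine (Finset.sum_le_card_nsmul _ _ 1 fun σ hσ => ?_).trans (le_of_eq ?_)
        · exact (htree.mem_Icc (mem_permsAgree.1 hσ) s).2
        · rw [hcard X f₀ hf₀ s (Finset.mem_sdiff.1 hs).1, hm]; simp
      · rw [nsmul_eq_mul]
        exact mul_le_mul_of_nonneg_right (by exact_mod_cast hdiff) (by positivity)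
    -- For the other shifts the answer is one of `m + 1` fresh values, and induction applies to
    -- each.
    have h2 : ∑ s ∈ shifts (insert x X),
        ∑ σ ∈ permsAgree X (F s) f₀, Φ (σ ∘ F s) s
          ≤ (m + 1) * (m.factorial * (1 + K * (X.card + 1 + K))) := by
      rw [Finset.sum_congr rfl fun s hs => sum_perm_agree_eq (f₀ := f₀) hx
        ((hF s (Finset.mem_filter.1 hs).2.1).injOn hs) fun σ => Φ (σ ∘ F s) s, Finset.sum_comm]
      refine (Finset.sum_le_card_nsmul _ _
        ((m.factorial : ℝ) * (1 + K * (X.card + 1 + K))) fun v hv => ?_).trans (le_of_eq ?_)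
      · have hv' := (Finset.mem_sdiff.1 hv).2
        have hupd : ∀ y ∈ X, Function.update f₀ x v y = f₀ y := fun y hy =>
          Function.update_of_ne (by rintro rfl; exact hx hy) _ _
        have hinj : Set.InjOn (Function.update f₀ x v) (insert x X : Finset (Bits n)) := by
          rw [Finset.coe_insert, Set.injOn_insert (by simpa using hx)]
          refine ⟨fun y hy z hz hyz => ?_, ?_⟩
          · rw [hupd y hy, hupd z hz] at hyz; exact hf₀ hy hz hyz
          · rintro ⟨y, hy, hyx⟩
            rw [hupd y hy, Function.update_self] at hyx
            exact hv' (Finset.mem_image.2 ⟨y, hy, hyx⟩)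
        have := ih (Function.update f₀ x v) hupd hinj
        rw [hm', Finset.card_insert_of_notMem hx] at this
        push_cast at this
        exact this
      · rw [nsmul_eq_mul, ← Finset.compl_eq_univ_sdiff, Finset.card_compl,
          Finset.card_image_of_injOn hf₀, hm]
        push_cast; ring
    refine (add_le_add h1 h2).trans ?_
    rw [hm, Nat.factorial_succ]
    push_cast
    have e : (0 : ℝ) ≤ (m + 1) * m.factorial := by positivity
    nlinarith [mul_nonneg e (Nat.cast_nonneg K : (0 : ℝ) ≤ K)]
  | @mix K X f₀ Φ ι t p Ψ h0 h1 h _ ih =>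
    calc _ = ∑ z ∈ t, p z * ∑ s ∈ shifts X,
          ∑ σ ∈ permsAgree X (F s) f₀, Ψ z (σ ∘ F s) s := by
          simp only [Finset.mul_sum]
          rw [Finset.sum_comm]
          refine Finset.sum_congr rfl fun s _ => ?_
          rw [Finset.sum_comm]
          exact Finset.sum_congr rfl fun σ hσ => h _ (mem_permsAgree.1 hσ) s
      _ ≤ ∑ z ∈ t, p z * ((Fintype.card (Bits n) - X.card).factorial * (1 + K * (X.card + K))) :=
          Finset.sum_le_sum fun z hz => mul_le_mul_of_nonneg_left (ih z hz hf₀) (h0 z hz)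
      _ ≤ _ := by
          rw [← Finset.sum_mul]
          exact mul_le_of_le_one_left (by positivity) h1

/-! ### Averaging over all Simon functions -/

open Classical in
/-- An involution of `Bits n` that carries the pairs with difference `s ≠ 0` to the pairs whose
difference is the all-ones string. -/
def shear (s x : Bits n) : Bits n :=
  if h : ∃ i, s i = 1 then x + x h.choose • (s + 1) else x

theorem exists_eq_one {s : Bits n} (hs : s ≠ 0) : ∃ i, s i = 1 := by
  by_contra! h
  exact hs (funext fun i => by
    have : ∀ a : ZMod 2, a ≠ 1 → a = 0 := by decide
    exact this _ (h i))

/-- At the chosen coordinate `s` is 1 and `s + 1` is 0. Hence `shear s` is linear, keeps that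
coordinate, and sends `s` to `s + (s + 1) = 1`. -/
theorem shear_add {s : Bits n} (hs : s ≠ 0) (x : Bits n) : shear s (x + s) = shear s x + 1 := by
  have h := exists_eq_one hs
  unfold shear
  rw [dif_pos h, dif_pos h, Pi.add_apply, h.choose_spec, add_smul, one_smul]
  rw [show x + s + (x h.choose • (s + 1) + (s + 1))
    = x + x h.choose • (s + 1) + 1 + (s + s) by abel, Bits.add_self, add_zero]

theorem shear_involutive (s : Bits n) : Function.Involutive (shear s) := by
  intro x
  unfold shear
  split_ifs with h
  · have h1 : (x + x h.choose • (s + 1)) h.choose = x h.choose := by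
      simp only [Pi.add_apply, Pi.smul_apply, h.choose_spec, Pi.one_apply]
      rw [CharTwo.add_self_eq_zero, smul_zero, add_zero]
    rw [h1, add_assoc, Bits.add_self, add_zero]
  · rfl

theorem isSimon_comp_shear {s : Bits n} (hs : s ≠ 0) {f : Bits n → Bits n} (hf : IsSimon 1 f) :
    IsSimon s (f ∘ shear s) := by
  refine ⟨hs, fun x y => ?_⟩
  rw [Function.comp_apply, Function.comp_apply, hf.2, ← shear_add hs,
    (shear_involutive s).injective.eq_iff, (shear_involutive s).injective.eq_iff]

theorem isSimon_one_comp_shear {s : Bits n} {f : Bits n → Bits n} (hf : IsSimon s f) :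
    IsSimon 1 (f ∘ shear s) := by
  have hs := hf.1
  have h1 : ∀ y, shear s (y + 1) = shear s y + s := by
    intro y
    rw [← shear_involutive s y, ← shear_add hs, shear_involutive, shear_involutive]
  refine ⟨?_, fun x y => ?_⟩
  · intro h
    have := h1 0
    rw [h, add_zero] at this
    exact hs (by simpa using this)
  · rw [Function.comp_apply, Function.comp_apply, hf.2, ← h1,
      (shear_involutive s).injective.eq_iff, (shear_involutive s).injective.eq_iff]

theorem isSimon_perm_comp {s : Bits n} {f : Bits n → Bits n} (hf : IsSimon s f)
    (σ : Equiv.Perm (Bits n)) : IsSimon s (σ ∘ f) :=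
  ⟨hf.1, fun x y => by simpa using hf.2 x y⟩

open Classical in
-- Precomposition with `shear s` identifies the Simon functions of any shift with those of shift 1,
-- so shift and function become independent.
theorem sum_simonPairs_eq (Φ : (Bits n → Bits n) → Bits n → ℝ) :
    ∑ q ∈ simonPairs n, Φ q.2 q.1
      = ∑ f with IsSimon (1 : Bits n) f, ∑ s with s ≠ 0, Φ (f ∘ shear s) s := by
  rw [← Finset.sum_product']
  refine Finset.sum_nbij' (fun q => (q.2 ∘ shear q.1, q.1)) (fun q => (q.2, q.1 ∘ shear q.2))
    ?_ ?_ ?_ ?_ ?_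
  · rintro ⟨s, f⟩ hq
    have hf := (Finset.mem_filter.1 hq).2
    exact Finset.mem_product.2 ⟨Finset.mem_filter.2 ⟨mem_univ _, isSimon_one_comp_shear hf⟩,
      Finset.mem_filter.2 ⟨mem_univ _, hf.1⟩⟩
  · rintro ⟨f, s⟩ hq
    rw [Finset.mem_product, Finset.mem_filter, Finset.mem_filter] at hq
    exact Finset.mem_filter.2 ⟨mem_univ _, isSimon_comp_shear hq.2.2 hq.1.2⟩
  · rintro ⟨s, f⟩ _
    simp [Function.comp_assoc, (shear_involutive s).comp_self]
  · rintro ⟨f, s⟩ _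
    simp [Function.comp_assoc, (shear_involutive s).comp_self]
  · rintro ⟨s, f⟩ _
    simp [Function.comp_assoc, (shear_involutive s).comp_self]

/-- Few queries to a uniformly random Simon function do not reveal its hidden shift. -/
theorem DecisionTree.sum_simonPairs_le {K : ℕ} {f₀ : Bits n → Bits n}
    {Φ : (Bits n → Bits n) → Bits n → ℝ} (h : DecisionTree K ∅ f₀ Φ) :
    (∑ q ∈ simonPairs n, Φ q.2 q.1) * (2 ^ n - 1) ≤ (simonPairs n).card * (1 + K ^ 2) := by
  classical
  have hcardB : Fintype.card (Bits n) = 2 ^ n := by simp [ZMod.card]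
  set S := univ.filter fun f => IsSimon (1 : Bits n) f with hS
  have hnz : ((univ.filter fun s : Bits n => s ≠ 0).card : ℝ) = 2 ^ n - 1 := by
    rw [Finset.filter_ne', Finset.card_erase_of_mem (mem_univ _), Finset.card_univ, hcardB,
      Nat.cast_sub Nat.one_le_two_pow]
    simp
  have hpairs : ((simonPairs n).card : ℝ) = S.card * (2 ^ n - 1) := by
    have := sum_simonPairs_eq (n := n) fun _ _ => 1
    simp only [Finset.sum_const, nsmul_eq_mul, mul_one] at this
    rw [this, hnz]
  have hshifts : shifts (∅ : Finset (Bits n)) = univ.filter fun s => s ≠ 0 := by simp [shifts]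
  have hfact : (0 : ℝ) < (2 ^ n).factorial := by positivity
  -- Relabelling the values permutes the Simon functions of shift 1. Averaging over `σ` gives the
  -- sum bounded in `DecisionTree.sum_le`.
  have hperm : ∀ σ : Equiv.Perm (Bits n), ∑ q ∈ simonPairs n, Φ q.2 q.1
      = ∑ f ∈ S, ∑ s with s ≠ 0, Φ (σ ∘ (f ∘ shear s)) s := by
    intro σ
    rw [sum_simonPairs_eq]
    refine Finset.sum_nbij' (fun f => σ.symm ∘ f) (fun f => σ ∘ f) ?_ ?_ ?_ ?_ ?_
    · intro f hf
      exact Finset.mem_filter.2 ⟨mem_univ _, isSimon_perm_comp (Finset.mem_filter.1 hf).2 _⟩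
    · intro f hf
      exact Finset.mem_filter.2 ⟨mem_univ _, isSimon_perm_comp (Finset.mem_filter.1 hf).2 _⟩
    · intro f _; funext x; simp
    · intro f _; funext x; simp
    · intro f _
      refine Finset.sum_congr rfl fun s _ => ?_
      congr 1; funext x; simp
  have key : ((2 ^ n).factorial : ℝ) * ∑ q ∈ simonPairs n, Φ q.2 q.1
      ≤ S.card * ((2 ^ n).factorial * (1 + K ^ 2)) := by
    calc _ = ∑ _σ : Equiv.Perm (Bits n), ∑ q ∈ simonPairs n, Φ q.2 q.1 := by
          rw [Finset.sum_const, Finset.card_univ, Fintype.card_perm, hcardB, nsmul_eq_mul]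
      _ = ∑ f ∈ S, ∑ s with s ≠ 0, ∑ σ : Equiv.Perm (Bits n), Φ (σ ∘ (f ∘ shear s)) s := by
          rw [Finset.sum_congr rfl fun σ _ => hperm σ, Finset.sum_comm]
          exact Finset.sum_congr rfl fun f _ => Finset.sum_comm
      _ ≤ ∑ _f ∈ S, ((2 ^ n).factorial * (1 + (K : ℝ) ^ 2)) := by
          refine Finset.sum_le_sum fun f hf => ?_
          have := h.sum_le (by simp) (fun s => f ∘ shear s) fun s hs =>
            isSimon_comp_shear hs (Finset.mem_filter.1 hf).2
          rw [hshifts] at this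
          simpa [permsAgree, Agree, hcardB, sq] using this
      _ = _ := by rw [Finset.sum_const, nsmul_eq_mul]
  have key' : ∑ q ∈ simonPairs n, Φ q.2 q.1 ≤ S.card * (1 + (K : ℝ) ^ 2) := by
    refine le_of_mul_le_mul_left ?_ hfact
    linarith
  have h2 : (0 : ℝ) ≤ 2 ^ n - 1 := by linarith [one_le_pow₀ (n := n) (by norm_num : (1 : ℝ) ≤ 2)]
  rw [hpairs]
  nlinarith [mul_le_mul_of_nonneg_right key' h2]

end Simon

/-! ### Simulating a scheme with classical queries to the Simon function. -/

section Simulation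

variable {n d : ℕ}

theorem unpad_pad (x : Bits n) : unpad (pad d x) = x := by
  funext i; simp [unpad, pad]

theorem pad_injective : Function.Injective (pad d : Bits n → Bits (wordLen n d)) :=
  Function.LeftInverse.injective unpad_pad

namespace QCircuit

variable (C : QCircuit n d) {θ : ℝ} (g : Fin d → Equiv.Perm (Bits (wordLen n d)))
  {f f' : Bits n → Bits n}

/-- A hybrid run depends on the Simon function only through its values at the open words. -/
theorem hybrid_congr {j : ℕ} (hj : j ≤ d)
    (h : ∀ x, pad d x ∈ (C.hybrid θ g f j).2 → f' x = f x) :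
    ∀ i ≤ j, C.hybrid θ g f' i = C.hybrid θ g f i
  | 0, _ => rfl
  | i + 1, hi => by
    have ih := hybrid_congr hj h i (by omega)
    have hid : i < d := by omega
    have h2 : (C.hybrid θ g f' (i + 1)).2 = (C.hybrid θ g f (i + 1)).2 := by
      rw [C.hybrid_succ_snd θ g f' ⟨i, hid⟩, C.hybrid_succ_snd θ g f ⟨i, hid⟩]
      simp only [ih]
    refine Prod.ext ?_ h2
    rw [C.hybrid_succ_fst θ g f' ⟨i, hid⟩, C.hybrid_succ_fst θ g f ⟨i, hid⟩]
    simp only [h2, ih]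
    rw [blockedOracle_congr g hid fun x hx => h x (C.hybrid_snd_mono θ g f hi hx)]

theorem totalLoad_congr {j : Fin d} (h : C.hybrid θ g f' j = C.hybrid θ g f j) :
    C.totalLoad θ g f' j = C.totalLoad θ g f j := by
  unfold totalLoad; rw [h]

end QCircuit

namespace DecisionTree

theorem congr {K : ℕ} {X : Finset (Bits n)} {f₀ : Bits n → Bits n}
    {Φ Ψ : (Bits n → Bits n) → Bits n → ℝ} (h : DecisionTree K X f₀ Ψ)
    (hΦ : ∀ f, Agree X f f₀ → Φ f = Ψ f) : DecisionTree K X f₀ Φ :=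
  mix (univ : Finset Unit) (fun _ => 1) (fun _ => Ψ) (by simp) (by simp)
    (fun f hf s => by simp [hΦ f hf]) fun _ _ => h

open Classical in
/-- The outcome of a hybrid run can be sampled with few queries to the Simon function. -/
theorem hybrid (C : QCircuit n d) {θ : ℝ} (hθ : 0 < θ)
    (g : Fin d → Equiv.Perm (Bits (wordLen n d))) (k : ℕ) {K : ℕ}
    {Ψ : Bits C.width → (Bits n → Bits n) → Bits n → ℝ}
    (hΨ : ∀ z X f₀, DecisionTree K X f₀ (Ψ z)) : ∀ m j : ℕ, j + m = d →
    ∀ (X : Finset (Bits n)) (f₀ : Bits n → Bits n),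
    (∀ i : Fin d, (i : ℕ) < j → C.totalLoad θ g f₀ i ≤ k) →
    (∀ x, pad d x ∈ (C.hybrid θ g f₀ j).2 → x ∈ X) →
    DecisionTree (K + m * k) X f₀ fun f s =>
      if C.Overloaded θ g f k then 0 else ∑ z, ‖(C.hybrid θ g f d).1 z‖ ^ 2 * Ψ z f s
  | 0, j, hj, X, f₀, hload, hX => by
    obtain rfl : j = d := hj
    have hrun : ∀ f, Agree X f f₀ → ∀ i ≤ j, C.hybrid θ g f i = C.hybrid θ g f₀ i :=
      fun f hf => C.hybrid_congr g le_rfl fun x hx => hf x (hX x hx)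
    rw [zero_mul, add_zero]
    refine mix univ (fun z => ‖(C.hybrid θ g f₀ j).1 z‖ ^ 2) Ψ (fun _ _ => by positivity)
      (C.sum_norm_sq_hybrid g f₀ j).le (fun f hf s => ?_) fun z _ => hΨ z X f₀
    rw [if_neg, hrun f hf j le_rfl]
    rintro ⟨i, hi⟩
    rw [C.totalLoad_congr g (hrun f hf i i.2.le)] at hi
    exact absurd hi (not_lt.2 (hload i i.2))
  | m + 1, j, hj, X, f₀, hload, hX => by
    have hjd : j < d := by omega
    have hrun : ∀ f, Agree X f f₀ → ∀ i ≤ j, C.hybrid θ g f i = C.hybrid θ g f₀ i :=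
      fun f hf => C.hybrid_congr g hjd.le fun x hx => hf x (hX x hx)
    -- The load of this round is determined by the known values, so the simulation can detect an
    -- overload and give up.
    by_cases hk : (k : ℝ) < C.totalLoad θ g f₀ ⟨j, hjd⟩
    · refine leaf (fun _ => 0) (fun _ => le_rfl) (by simp) fun f hf => ?_
      funext s
      refine if_pos ⟨⟨j, hjd⟩, ?_⟩
      rwa [C.totalLoad_congr g (hrun f hf j le_rfl)]
    · push Not at hk
      set H := heavySet θ (C.parallel ⟨j, hjd⟩) (C.hybrid θ g f₀ j).1 (stage g) (j + 1) with hH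
      -- Only newly opened padded strings lead to values of the Simon function, and there are at
      -- most `k` of them.
      set Z : Finset (Bits n) := univ.filter fun x => pad d x ∈ H \ (C.hybrid θ g f₀ j).2 with hZ
      have hZk : Z.card ≤ k := by
        have h1 : Z.card ≤ (H \ (C.hybrid θ g f₀ j).2).card :=
          Finset.card_le_card_of_injOn (pad d) (fun x hx => (Finset.mem_filter.1 hx).2)
            pad_injective.injOn
        have h2 := (C.card_heavySet_sdiff_le g f₀ hθ ⟨j, hjd⟩).trans hk
        exact h1.trans (by exact_mod_cast h2)
      have htree : DecisionTree (K + m * k + Z.card) X f₀ fun f s =>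
          if C.Overloaded θ g f k then 0 else ∑ z, ‖(C.hybrid θ g f d).1 z‖ ^ 2 * Ψ z f s := by
        refine ask_set Z fun f hf => ?_
        have hj' := hrun f hf j le_rfl
        refine hybrid C hθ g k hΨ m (j + 1) (by omega) (X ∪ Z) f ?_ ?_
        · intro i hi
          rw [C.totalLoad_congr g (hrun f hf i (by omega))]
          rcases Nat.lt_succ_iff_lt_or_eq.1 hi with h | h
          · exact hload i h
          · obtain rfl : i = ⟨j, hjd⟩ := Fin.ext h
            exact hk
        · intro x hx
          rw [C.hybrid_succ_snd θ g f ⟨j, hjd⟩] at hx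
          simp only [hj'] at hx
          by_cases hx' : pad d x ∈ (C.hybrid θ g f₀ j).2
          · exact Finset.mem_union_left _ (hX x hx')
          · refine Finset.mem_union_right _ (Finset.mem_filter.2 ⟨mem_univ _, ?_⟩)
            exact Finset.mem_sdiff.2 ⟨(Finset.mem_union.1 hx).resolve_left hx', hx'⟩
      refine htree.mono ?_
      rw [add_mul, one_mul, ← add_assoc]
      exact Nat.add_le_add_left hZk _

end DecisionTree

namespace CQScheme

open Classical in
/-- The probability that a scheme outputs `s` when its quantum circuits are replaced by their
hybrid runs, giving up when a circuit is overloaded. -/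
def simProb (θ : ℝ) (k : ℕ) (g : Fin d → Equiv.Perm (Bits (wordLen n d))) (f : Bits n → Bits n)
    (s : Bits n) : CQScheme n d → ℝ
  | output z => if z = s then 1 else 0
  | coin next => ((next false).simProb θ k g f s + (next true).simProb θ k g f s) / 2
  | query i x next => (next (shuffling f g i x)).simProb θ k g f s
  | circuit C next => if C.Overloaded θ g f k then 0 else
      ∑ z, ‖(C.hybrid θ g f d).1 z‖ ^ 2 * (next z).simProb θ k g f s

/-- The scheme with hybrid runs makes few queries to the Simon function. -/
theorem decisionTree_simProb {θ : ℝ} (hθ : 0 < θ) (k : ℕ)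
    (g : Fin d → Equiv.Perm (Bits (wordLen n d))) (A : CQScheme n d) :
    ∀ (X : Finset (Bits n)) (f₀ : Bits n → Bits n),
      DecisionTree (A.queryCount + A.circuitCount * (d * k)) X f₀
        fun f s => A.simProb θ k g f s := by
  induction A with
  | output z =>
    intro X f₀
    refine .leaf (fun s => if z = s then 1 else 0) (fun s => ?_) (by simp) fun f _ => rfl
    split_ifs <;> norm_num
  | coin next ih =>
    intro X f₀
    refine .mix univ (fun _ => 1 / 2) (fun b f s => (next b).simProb θ k g f s)
      (by norm_num) (by norm_num) (fun f _ s => ?_) fun b _ => (ih b X f₀).mono ?_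
    · rw [Fintype.sum_bool, simProb]; ring
    · refine Nat.add_le_add ?_ (Nat.mul_le_mul_right _ ?_)
      · exact Finset.le_sup (f := fun b => (next b).queryCount) (mem_univ b)
      · exact Finset.le_sup (f := fun b => (next b).circuitCount) (mem_univ b)
  | query i x next ih =>
    have hle : ∀ y, (next y).queryCount + (next y).circuitCount * (d * k) + 1
        ≤ (query i x next).queryCount + (query i x next).circuitCount * (d * k) := by
      intro y
      have h1 := Finset.le_sup (f := fun y => (next y).queryCount) (mem_univ y)
      have h2 := Finset.le_sup (f := fun y => (next y).circuitCount) (mem_univ y)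
      have h3 := Nat.mul_le_mul_right (d * k) h2
      simp only [queryCount, circuitCount] at *
      omega
    intro X f₀
    have hconst : ∀ y, (∀ f, shuffling f g i x = y) →
        DecisionTree ((query i x next).queryCount + (query i x next).circuitCount * (d * k)) X f₀
          fun f s => (query i x next).simProb θ k g f s := by
      intro y hy
      refine ((ih y X f₀).mono (Nat.le_of_succ_le (hle y))).congr fun f _ => ?_
      funext s
      rw [simProb, hy]
    -- The functions before the last, and the value `⊥` of the last, do not depend on `f` and cost
    -- no query.
    by_cases hi : (i : ℕ) < d
    · exact hconst _ fun f => shuffling_of_lt f g hi x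
    by_cases hp : pad d (unpad ((stage g d).symm x)) = (stage g d).symm x
    · have hv : ∀ f, shuffling f g i x = some (pad d (f (unpad ((stage g d).symm x)))) :=
        fun f => (shuffling_of_not_lt f g hi x).trans (if_pos hp)
      obtain ⟨K, hK⟩ : ∃ K, (query i x next).queryCount + (query i x next).circuitCount * (d * k)
          = K + 1 := ⟨_, (Nat.succ_pred_eq_of_pos (lt_of_lt_of_le (Nat.succ_pos _)
            (hle none))).symm⟩
      rw [hK]
      refine .ask (unpad ((stage g d).symm x)) fun f₁ _ => ?_
      have := hle (some (pad d (f₁ (unpad ((stage g d).symm x)))))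
      refine ((ih (some (pad d (f₁ (unpad ((stage g d).symm x))))) _ f₁).mono
        (by omega)).congr fun f hf => ?_
      funext s
      rw [simProb, hv, hf _ (Finset.mem_insert_self _ _)]
    · exact hconst none fun f => (shuffling_of_not_lt f g hi x).trans (if_neg hp)
  | circuit C next ih =>
    intro X f₀
    have hle : ∀ z, (next z).queryCount + (next z).circuitCount * (d * k)
        ≤ (univ.sup fun z => (next z).queryCount)
          + (univ.sup fun z => (next z).circuitCount) * (d * k) := fun z =>
      Nat.add_le_add (Finset.le_sup (f := fun z => (next z).queryCount) (mem_univ z))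
        (Nat.mul_le_mul_right _
          (Finset.le_sup (f := fun z => (next z).circuitCount) (mem_univ z)))
    have := DecisionTree.hybrid C hθ g k (Ψ := fun z f s => (next z).simProb θ k g f s)
      (fun z X f₀ => (ih z X f₀).mono (hle z)) d 0 (by omega) X f₀ (by simp)
      (by simp [QCircuit.hybrid])
    refine (this.mono ?_).congr fun f _ => ?_
    · simp only [queryCount, circuitCount]
      rw [add_mul, one_mul, add_comm (d * k), add_assoc]
    · funext s; rw [simProb]

theorem outputProb_mem_Icc (F : OracleFn n d) (s : Bits n) (A : CQScheme n d) :
    A.outputProb F s ∈ Set.Icc (0 : ℝ) 1 := by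
  induction A with
  | output z => unfold outputProb; split_ifs <;> simp
  | coin next ih =>
    obtain ⟨h1, h2⟩ := ih false
    obtain ⟨h3, h4⟩ := ih true
    rw [outputProb]
    constructor <;> linarith
  | query i x next ih => exact ih _
  | circuit C next ih =>
    have h0 : ∀ z, 0 ≤ C.outcomeProb F z := fun z => by unfold QCircuit.outcomeProb; positivity
    rw [outputProb]
    refine ⟨Finset.sum_nonneg fun z _ => mul_nonneg (h0 z) (ih z).1, ?_⟩
    rw [← C.sum_outcomeProb F]
    exact Finset.sum_le_sum fun z _ => mul_le_of_le_one_right (h0 z) (ih z).2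

open Classical in
/-- The number of overloaded circuits in a scheme, averaged over coin tosses. -/
def overloadCount (θ : ℝ) (k : ℕ) (g : Fin d → Equiv.Perm (Bits (wordLen n d)))
    (f : Bits n → Bits n) : CQScheme n d → ℝ
  | output _ => 0
  -- Coins are averaged because their number is not bounded. Answers and outcomes are summed without
  -- weights, so the count covers every circuit that any oracle could lead to, whatever `g` is.
  | coin next => ((next false).overloadCount θ k g f + (next true).overloadCount θ k g f) / 2
  | query _ _ next => ∑ y, (next y).overloadCount θ k g f
  | circuit C next => (if C.Overloaded θ g f k then 1 else 0)
      + ∑ z, (next z).overloadCount θ k g f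

section Bounds

variable {θ : ℝ} {k : ℕ} {g : Fin d → Equiv.Perm (Bits (wordLen n d))} {f : Bits n → Bits n}

theorem overloadCount_nonneg (A : CQScheme n d) : 0 ≤ A.overloadCount θ k g f := by
  induction A with
  | output z => exact le_rfl
  | coin next ih => rw [overloadCount]; linarith [ih false, ih true]
  | query i x next ih => exact Finset.sum_nonneg fun y _ => ih y
  | circuit C next ih =>
    rw [overloadCount]
    exact add_nonneg (by split_ifs <;> norm_num) (Finset.sum_nonneg fun y _ => ih y)

/-- Circuits are replaced one by one. One that is not overloaded costs its distance to the hybrid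
run, and an overloaded one costs at most 1, which `overloadCount` pays. -/
theorem outputProb_le (hθ : 0 < θ) (hd : 1 ≤ d) (s : Bits n) (A : CQScheme n d) :
    A.outputProb (shuffling f g) s ≤ A.simProb θ k g f s
      + A.circuitCount * (4 * d * Real.sqrt (d * θ * k)) + A.overloadCount θ k g f := by
  set η := 4 * d * Real.sqrt (d * θ * k) with hη
  have hη0 : 0 ≤ η := by positivity
  induction A with
  | output z => simp [outputProb, simProb, circuitCount, overloadCount]
  | coin next ih =>
    have hle : ∀ b, ((next b).circuitCount : ℝ) * η ≤ (coin next).circuitCount * η := fun b =>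
      mul_le_mul_of_nonneg_right (by
        exact_mod_cast Finset.le_sup (f := fun b => (next b).circuitCount) (mem_univ b)) hη0
    rw [outputProb, simProb, overloadCount]
    linarith [ih false, ih true, hle false, hle true]
  | query i x next ih =>
    rw [outputProb, simProb, overloadCount]
    refine (ih _).trans (add_le_add (add_le_add le_rfl (mul_le_mul_of_nonneg_right ?_ hη0)) ?_)
    · exact_mod_cast Finset.le_sup (f := fun y => (next y).circuitCount) (mem_univ _)
    · exact Finset.single_le_sum (f := fun y => (next y).overloadCount θ k g f)
        (fun y _ => (next y).overloadCount_nonneg) (mem_univ _)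
  | circuit C next ih =>
    have hsum : 0 ≤ ∑ z, (next z).overloadCount θ k g f :=
      Finset.sum_nonneg fun z _ => (next z).overloadCount_nonneg
    by_cases hC : C.Overloaded θ g f k
    · have h1 := (outputProb_mem_Icc (shuffling f g) s (circuit C next)).2
      rw [simProb, overloadCount, if_pos hC, if_pos hC]
      have h2 : 0 ≤ ((circuit C next).circuitCount : ℝ) * η := by positivity
      linarith
    · rw [outputProb, simProb, overloadCount, if_neg hC, if_neg hC, zero_add]
      set M := univ.sup fun z => (next z).circuitCount with hM
      have hcc : ((circuit C next).circuitCount : ℝ) = 1 + M := by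
        rw [circuitCount]; push_cast; rfl
      have hp := C.sum_abs_outcomeProb_sub_le g f hθ hd hC
      set p := C.outcomeProb (shuffling f g)
      set p' := fun z => ‖(C.hybrid θ g f d).1 z‖ ^ 2 with hp'
      have hp0 : ∀ z, 0 ≤ p' z := fun z => by positivity
      have hps : ∑ z, p' z = 1 := C.sum_norm_sq_hybrid g f d
      have hp1 : ∀ z, p' z ≤ 1 := fun z => by
        rw [← hps]; exact Finset.single_le_sum (fun z _ => hp0 z) (mem_univ z)
      calc ∑ z, p z * (next z).outputProb (shuffling f g) s
          ≤ ∑ z, (|p z - p' z| + (p' z * (next z).simProb θ k g f s + p' z * (M * η)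
              + (next z).overloadCount θ k g f)) := by
            refine Finset.sum_le_sum fun z _ => ?_
            have hR := outputProb_mem_Icc (shuffling f g) s (next z)
            have h1 : p z * (next z).outputProb (shuffling f g) s
                ≤ |p z - p' z| + p' z * (next z).outputProb (shuffling f g) s := by
              have h3 := mul_le_mul_of_nonneg_right (le_abs_self (p z - p' z)) hR.1
              have h4 := mul_le_of_le_one_right (abs_nonneg (p z - p' z)) hR.2
              linarith
            have h2 := mul_le_mul_of_nonneg_left (ih z) (hp0 z)
            have h5 : ((next z).circuitCount : ℝ) * η ≤ M * η :=
              mul_le_mul_of_nonneg_right (by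
                exact_mod_cast Finset.le_sup (f := fun z => (next z).circuitCount)
                  (mem_univ z)) hη0
            have h6 := mul_le_mul_of_nonneg_left h5 (hp0 z)
            have h7 := mul_le_of_le_one_left
              ((next z).overloadCount_nonneg (θ := θ) (k := k) (g := g) (f := f)) (hp1 z)
            linarith
        _ = ∑ z, |p z - p' z| + (∑ z, p' z * (next z).simProb θ k g f s + M * η
              + ∑ z, (next z).overloadCount θ k g f) := by
            rw [Finset.sum_add_distrib, Finset.sum_add_distrib, Finset.sum_add_distrib,
              ← Finset.sum_mul, hps, one_mul]
        _ ≤ _ := by rw [hcc]; linarith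

end Bounds

open Classical in
/-- A union bound over all circuits that may occur in a run of a scheme. -/
theorem sum_overloadCount_le {θ : ℝ} {k W : ℕ} {f : Bits n → Bits n} {β : ℝ} (hβ : 0 ≤ β)
    (h : ∀ C : QCircuit n d, C.width ≤ W →
      ((univ.filter fun g => C.Overloaded θ g f k).card : ℝ) ≤ β) (A : CQScheme n d)
    (hW : A.maxWidth ≤ W) : ∑ g, A.overloadCount θ k g f
      ≤ β * ((2 ^ (wordLen n d + 1)) ^ A.queryCount * (2 ^ (W + 1)) ^ A.circuitCount) := by
  set a : ℝ := 2 ^ (wordLen n d + 1) with ha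
  set b : ℝ := 2 ^ (W + 1) with hb
  have ha1 : 1 ≤ a := one_le_pow₀ (by norm_num)
  have hb1 : 1 ≤ b := one_le_pow₀ (by norm_num)
  have hmono : ∀ {q q' c c' : ℕ}, q ≤ q' → c ≤ c' → β * (a ^ q * b ^ c) ≤ β * (a ^ q' * b ^ c') := by
    intro q q' c c' hq hc
    gcongr
  induction A with
  | output z => simp [overloadCount]; positivity
  | coin next ih =>
    have hle : ∀ i, ∑ g, (next i).overloadCount θ k g f
        ≤ β * (a ^ (coin next).queryCount * b ^ (coin next).circuitCount) := fun i =>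
      (ih i ((Finset.le_sup (f := fun i => (next i).maxWidth) (mem_univ i)).trans hW)).trans
        (hmono (Finset.le_sup (f := fun i => (next i).queryCount) (mem_univ i))
          (Finset.le_sup (f := fun i => (next i).circuitCount) (mem_univ i)))
    simp only [overloadCount]
    rw [← Finset.sum_div, Finset.sum_add_distrib]
    linarith [hle false, hle true]
  | query i x next ih =>
    simp only [overloadCount]
    rw [Finset.sum_comm]
    set q := univ.sup fun y => (next y).queryCount with hq
    set c := univ.sup fun y => (next y).circuitCount with hc
    have hle : ∀ y, ∑ g, (next y).overloadCount θ k g f ≤ β * (a ^ q * b ^ c) := fun y =>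
      (ih y ((Finset.le_sup (f := fun i => (next i).maxWidth) (mem_univ y)).trans hW)).trans
        (hmono (Finset.le_sup (f := fun i => (next i).queryCount) (mem_univ y))
          (Finset.le_sup (f := fun i => (next i).circuitCount) (mem_univ y)))
    refine (Finset.sum_le_card_nsmul _ _ _ fun y _ => hle y).trans ?_
    have hcard : ((univ : Finset (Option (Bits (wordLen n d)))).card : ℝ) ≤ a := by
      have h1 : (1 : ℝ) ≤ 2 ^ wordLen n d := one_le_pow₀ (by norm_num)
      rw [Finset.card_univ, Fintype.card_option, Fintype.card_fun, ZMod.card, Fintype.card_fin, ha,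
        pow_succ]
      push_cast
      linarith
    rw [nsmul_eq_mul]
    calc _ ≤ a * (β * (a ^ q * b ^ c)) := mul_le_mul_of_nonneg_right hcard (by positivity)
      _ = β * (a ^ (1 + q) * b ^ c) := by ring
  | circuit C next ih =>
    have hCW : C.width ≤ W := (le_max_left _ _).trans hW
    have hnW : (univ.sup fun z => (next z).maxWidth) ≤ W := (le_max_right _ _).trans hW
    simp only [overloadCount]
    rw [Finset.sum_add_distrib, Finset.sum_comm, Finset.sum_boole]
    set q := univ.sup fun y => (next y).queryCount with hq
    set c := univ.sup fun y => (next y).circuitCount with hc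
    have hle : ∀ y, ∑ g, (next y).overloadCount θ k g f ≤ β * (a ^ q * b ^ c) := fun y =>
      (ih y ((Finset.le_sup (f := fun i => (next i).maxWidth) (mem_univ y)).trans hnW)).trans
        (hmono (Finset.le_sup (f := fun i => (next i).queryCount) (mem_univ y))
          (Finset.le_sup (f := fun i => (next i).circuitCount) (mem_univ y)))
    have hsum := Finset.sum_le_card_nsmul univ _ _ fun y _ => hle y
    -- The additional 1 stands for the circuit at this node itself.
    have hcard : ((univ : Finset (Bits C.width)).card : ℝ) + 1 ≤ b := by
      have h1 : (1 : ℝ) ≤ 2 ^ W := one_le_pow₀ (by norm_num)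
      have h2 : (2 : ℝ) ^ C.width ≤ 2 ^ W := pow_le_pow_right₀ (by norm_num) hCW
      rw [Finset.card_univ, Fintype.card_fun, ZMod.card, Fintype.card_fin, hb, pow_succ]
      push_cast
      linarith
    rw [nsmul_eq_mul] at hsum
    have hX : β ≤ β * (a ^ q * b ^ c) := le_mul_of_one_le_right hβ
      (one_le_mul_of_one_le_of_one_le (one_le_pow₀ ha1) (one_le_pow₀ hb1))
    calc _ ≤ β * (a ^ q * b ^ c) + (univ : Finset (Bits C.width)).card * (β * (a ^ q * b ^ c)) :=
          add_le_add ((h C hCW).trans hX) hsum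
      _ = ((univ : Finset (Bits C.width)).card + 1) * (β * (a ^ q * b ^ c)) := by ring
      _ ≤ b * (β * (a ^ q * b ^ c)) := mul_le_mul_of_nonneg_right hcard (by positivity)
      _ = β * (a ^ q * b ^ (1 + c)) := by ring

end CQScheme

end Simulation

/-! ### Adding up the errors. -/

section Conclusion

variable {n d : ℕ}

namespace CQScheme

theorem successProb_le_one (A : CQScheme n d) : A.successProb ≤ 1 := by
  unfold successProb
  refine div_le_one_of_le₀ ?_ (by positivity)
  have : ∀ q ∈ simonPairs n, ∑ g : Fin d → Equiv.Perm (Bits (wordLen n d)),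
      A.outputProb (shuffling q.2 g) q.1
        ≤ Fintype.card (Fin d → Equiv.Perm (Bits (wordLen n d))) := by
    intro q _
    refine (Finset.sum_le_card_nsmul _ _ 1 fun g _ => (A.outputProb_mem_Icc _ _).2).trans ?_
    simp
  refine (Finset.sum_le_card_nsmul _ _ _ this).trans ?_
  rw [nsmul_eq_mul]

open Classical in
/-- The success probability of a scheme in terms of the probability `β` that a circuit is
overloaded. -/
theorem successProb_le (hn : 1 ≤ n) (hd : 1 ≤ d) {θ β : ℝ} (hθ : 0 < θ) (hβ : 0 ≤ β) {k P W : ℕ}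
    (h : ∀ (f : Bits n → Bits n) (C : QCircuit n d), C.width ≤ W →
      ((univ.filter fun g => C.Overloaded θ g f k).card : ℝ)
        ≤ β * Fintype.card (Fin d → Equiv.Perm (Bits (wordLen n d))))
    (A : CQScheme n d) (hc : A.circuitCount ≤ P) (hq : A.queryCount ≤ P) (hw : A.maxWidth ≤ W) :
    A.successProb ≤ 2 * (1 + ((P + P * (d * k) : ℕ) : ℝ) ^ 2) / 2 ^ n
      + P * (4 * d * Real.sqrt (d * θ * k))
      + β * ((2 ^ (wordLen n d + 1)) ^ P * (2 ^ (W + 1)) ^ P) := by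
  set G : ℝ := (Fintype.card (Fin d → Equiv.Perm (Bits (wordLen n d))) : ℝ) with hG
  have hG0 : 0 < G := by rw [hG]; exact_mod_cast Fintype.card_pos
  set K := P + P * (d * k) with hK
  set η := 4 * d * Real.sqrt (d * θ * k) with hη
  set M : ℝ := (2 ^ (wordLen n d + 1)) ^ P * (2 ^ (W + 1)) ^ P with hM
  have hη0 : 0 ≤ η := by positivity
  unfold successProb
  set S : ℝ := ((simonPairs n).card : ℝ) with hS
  have hS0 : 0 ≤ S := by positivity
  have h2n : (2 : ℝ) ≤ 2 ^ n := by
    calc (2 : ℝ) = 2 ^ 1 := by norm_num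
      _ ≤ 2 ^ n := pow_le_pow_right₀ (by norm_num) hn
  rw [← hG]
  refine div_le_of_le_mul₀ (by positivity) (by positivity) ?_
  have hsim : ∑ q ∈ simonPairs n, ∑ g, A.simProb θ k g q.2 q.1
      ≤ G * (S * (2 * (1 + (K : ℝ) ^ 2) / 2 ^ n)) := by
    rw [Finset.sum_comm]
    refine (Finset.sum_le_card_nsmul _ _ (S * (2 * (1 + (K : ℝ) ^ 2) / 2 ^ n))
      fun g _ => ?_).trans (by rw [nsmul_eq_mul, Finset.card_univ])
    have hle : A.queryCount + A.circuitCount * (d * k) ≤ K :=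
      Nat.add_le_add hq (Nat.mul_le_mul_right _ hc)
    have := ((A.decisionTree_simProb hθ k g ∅ id).mono hle).sum_simonPairs_le
    have hpos : (0 : ℝ) < 2 ^ n - 1 := by linarith
    rw [← le_div_iff₀ hpos] at this
    refine this.trans ?_
    rw [mul_div_assoc]
    refine mul_le_mul_of_nonneg_left ?_ hS0
    -- The factor 2 absorbs the passage from `2 ^ n - 1` to `2 ^ n`.
    rw [div_le_div_iff₀ hpos (by positivity)]
    have : (0 : ℝ) ≤ 1 + (K : ℝ) ^ 2 := by positivity
    nlinarith
  have hload : ∑ q ∈ simonPairs n, ∑ g, A.overloadCount θ k g q.2 ≤ S * (β * G * M) := by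
    refine (Finset.sum_le_card_nsmul _ _ (β * G * M) fun q _ => ?_).trans (by rw [nsmul_eq_mul])
    refine (sum_overloadCount_le (by positivity) (h q.2) A hw).trans ?_
    refine mul_le_mul_of_nonneg_left ?_ (by positivity)
    rw [hM]
    gcongr <;> first | assumption | exact one_le_pow₀ (by norm_num)
  calc _ ≤ ∑ q ∈ simonPairs n, ∑ g, (A.simProb θ k g q.2 q.1 + P * η
        + A.overloadCount θ k g q.2) := by
        refine Finset.sum_le_sum fun q _ => Finset.sum_le_sum fun g _ => ?_
        refine (A.outputProb_le (k := k) hθ hd q.1).trans ?_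
        have : (A.circuitCount : ℝ) * η ≤ P * η :=
          mul_le_mul_of_nonneg_right (by exact_mod_cast hc) hη0
        linarith
    _ = ∑ q ∈ simonPairs n, ∑ g, A.simProb θ k g q.2 q.1 + S * (G * (P * η))
        + ∑ q ∈ simonPairs n, ∑ g, A.overloadCount θ k g q.2 := by
        simp only [Finset.sum_add_distrib, Finset.sum_const, nsmul_eq_mul, Finset.card_univ]
        rfl
    _ ≤ G * (S * (2 * (1 + (K : ℝ) ^ 2) / 2 ^ n)) + S * (G * (P * η)) + S * (β * G * M) :=
        add_le_add (add_le_add hsim le_rfl) hload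
    _ = _ := by ring

end CQScheme

/-! ### Error terms -/

section Errors

variable {a k P : ℕ} {t : ℝ}

theorem query_error_le (ht : 0 ≤ t) (hinv : 1 / 2 ^ n ≤ t) (hd : 1 ≤ d) (hda : d ≤ a)
    (hP : P ≤ a) (k : ℕ) : 2 * (1 + ((P + P * (d * k) : ℕ) : ℝ) ^ 2) / 2 ^ n
      ≤ d * (2 * (1 + ((a : ℝ) + a ^ 2 * k) ^ 2) * t) := by
  have h1 : P + P * (d * k) ≤ a + a ^ 2 * k := by
    have : P * (d * k) ≤ a * (a * k) := Nat.mul_le_mul hP (Nat.mul_le_mul_right _ hda)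
    calc _ ≤ a + a * (a * k) := add_le_add hP this
      _ = _ := by ring
  have h1' : ((P + P * (d * k) : ℕ) : ℝ) ≤ a + a ^ 2 * k := by exact_mod_cast h1
  have h2 : 2 * (1 + ((P + P * (d * k) : ℕ) : ℝ) ^ 2) ≤ 2 * (1 + ((a : ℝ) + a ^ 2 * k) ^ 2) := by
    gcongr
  rw [← mul_one_div]
  calc _ ≤ 2 * (1 + ((a : ℝ) + a ^ 2 * k) ^ 2) * t :=
        mul_le_mul h2 hinv (by positivity) (by positivity)
    _ ≤ _ := le_mul_of_one_le_left (by positivity) (by exact_mod_cast hd)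

theorem circuit_error_le (ht : 0 ≤ t) (htsq : t ^ 2 = 1 / 2 ^ n) (hda : d ≤ a) (hk : 1 ≤ k)
    (hP : P ≤ a) : P * (4 * d * Real.sqrt (d * (2 * a / 2 ^ n) * k))
      ≤ d * (8 * (a : ℝ) ^ 3 * k * t) := by
  rcases Nat.eq_zero_or_pos a with rfl | ha
  · obtain rfl : P = 0 := by omega
    simp
  have hda' : (d : ℝ) ≤ a := by exact_mod_cast hda
  have hP' : (P : ℝ) ≤ a := by exact_mod_cast hP
  have h2 : (1 : ℝ) ≤ 2 * a ^ 2 * k := by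
    exact_mod_cast Nat.succ_le_of_lt (by positivity : 0 < 2 * a ^ 2 * k)
  -- `√x ≤ x` for `x ≥ 1` keeps the coefficient polynomial.
  have h1 : Real.sqrt (d * (2 * a / 2 ^ n) * k) ≤ 2 * a ^ 2 * k * t := by
    refine Real.sqrt_le_iff.2 ⟨by positivity, ?_⟩
    rw [mul_pow, htsq]
    calc (d : ℝ) * (2 * a / 2 ^ n) * k ≤ a * (2 * a / 2 ^ n) * k := by gcongr
      _ = (2 * a ^ 2 * k) * (1 / 2 ^ n) := by ring
      _ ≤ (2 * a ^ 2 * k) ^ 2 * (1 / 2 ^ n) := by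
          refine mul_le_mul_of_nonneg_right ?_ (by positivity)
          exact le_self_pow₀ h2 (by norm_num)
  calc _ ≤ (a : ℝ) * (4 * d * (2 * a ^ 2 * k * t)) := by gcongr
    _ = _ := by ring

theorem overload_error_le (hinv : 1 / 2 ^ n ≤ t) (hk : k = (a * n + 1) * a + a * a + n)
    (hdP : d + 2 ≤ P) (haP : a = P + 1) :
    3 * (d : ℝ) / 2 ^ k * ((2 ^ (wordLen n d + 1)) ^ P * (2 ^ (P + 1)) ^ P) ≤ d * (3 * t) := by
  have h1 : ((2 : ℝ) ^ (wordLen n d + 1)) ^ P * (2 ^ (P + 1)) ^ P * 2 ^ n ≤ 2 ^ k := by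
    rw [← pow_mul, ← pow_mul, ← pow_add, ← pow_add]
    refine pow_le_pow_right₀ (by norm_num) ?_
    rw [hk]
    have h2 : wordLen n d ≤ a * n := Nat.mul_le_mul_right _ (by omega)
    have h3 : (wordLen n d + 1) * P ≤ (a * n + 1) * a := Nat.mul_le_mul (by omega) (by omega)
    have h4 : (P + 1) * P ≤ a * a := Nat.mul_le_mul (by omega) (by omega)
    exact Nat.add_le_add_right (Nat.add_le_add h3 h4) n
  calc _ = 3 * (d : ℝ) * (((2 ^ (wordLen n d + 1)) ^ P * (2 ^ (P + 1)) ^ P) / 2 ^ k) := by ring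
    _ ≤ 3 * d * (1 / 2 ^ n) := by
        refine mul_le_mul_of_nonneg_left ?_ (by positivity)
        rw [div_le_div_iff₀ (by positivity) (by positivity), one_mul]
        exact h1
    _ ≤ 3 * d * t := by gcongr
    _ = _ := by ring

end Errors

end Conclusion

end ShufflingOracle

end

theorem mainTheorem4 (p : Polynomial ℕ) :
    ∃ r : Polynomial ℕ, ∀ n d : ℕ, 1 ≤ n → 1 ≤ d → ∀ A : CQScheme n d,
      A.circuitCount ≤ p.eval n → A.queryCount ≤ p.eval n → A.maxWidth ≤ p.eval n →
        A.successProb ≤ d * Real.sqrt ((r.eval n : ℕ) / 2 ^ n) := by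
  classical
  let a : Polynomial ℕ := p + 1
  -- The exponent of the union bound, `(wordLen n d + 1) * P + (P + 1) * P`, is at most `k - n`, so
  -- a factor `2 ^ (-n)` is left over.
  let k : Polynomial ℕ := (a * .X + 1) * a + a * a + .X
  -- The three summands belong to `circuit_error_le`, `overload_error_le` and `query_error_le`.
  let R : Polynomial ℕ := 8 * a ^ 3 * k + 3 + 2 * (1 + (a + a ^ 2 * k) ^ 2)
  refine ⟨R ^ 2, fun n d hn hd A hc hq hw => ?_⟩
  obtain ⟨a', ha'⟩ : ∃ a', a' = a.eval n := ⟨_, rfl⟩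
  obtain ⟨k', hk'⟩ : ∃ k', k' = k.eval n := ⟨_, rfl⟩
  obtain ⟨R', hR'⟩ : ∃ R', R' = R.eval n := ⟨_, rfl⟩
  obtain ⟨P, hP⟩ : ∃ P, P = p.eval n := ⟨_, rfl⟩
  have hkval : k' = (a' * n + 1) * a' + a' * a' + n := by simp [hk', ha', k]
  have hRval : R' = 8 * a' ^ 3 * k' + 3 + 2 * (1 + (a' + a' ^ 2 * k') ^ 2) := by
    simp [hR', hk', ha', R]
  have haval : a' = P + 1 := by simp [ha', hP, a]
  rw [Polynomial.eval_pow, ← hR']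
  rw [← hP] at hc hq hw
  clear_value a k R
  have h2n0 : (0 : ℝ) < 2 ^ n := by positivity
  have hd1 : (1 : ℝ) ≤ d := by exact_mod_cast hd
  have hroot : (d : ℝ) * Real.sqrt (((R' ^ 2 : ℕ) : ℝ) / 2 ^ n)
      = d * (R' * Real.sqrt (1 / 2 ^ n)) := by
    push_cast
    rw [← mul_one_div, Real.sqrt_mul (by positivity), Real.sqrt_sq (by positivity)]
  -- If `2 ^ n ≤ R' ^ 2`, the claimed bound is at least 1. Otherwise `n` is large enough for the
  -- tail bound.
  by_cases htriv : 2 ^ n ≤ R' ^ 2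
  · refine A.successProb_le_one.trans ?_
    have : (1 : ℝ) ≤ Real.sqrt (((R' ^ 2 : ℕ) : ℝ) / 2 ^ n) := by
      rw [Real.one_le_sqrt, one_le_div h2n0]
      exact_mod_cast htriv
    nlinarith
  push Not at htriv
  rw [hroot]
  set t := Real.sqrt (1 / 2 ^ n) with ht
  have ht0 : 0 ≤ t := Real.sqrt_nonneg _
  have htsq : t ^ 2 = 1 / 2 ^ n := Real.sq_sqrt (by positivity)
  have ht1 : t ≤ 1 := by
    rw [ht, Real.sqrt_le_one]
    rw [div_le_one h2n0]
    exact one_le_pow₀ (by norm_num)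
  have hinv : 1 / 2 ^ n ≤ t := by rw [← htsq]; nlinarith
  have hRreal : (R' : ℝ) = 8 * a' ^ 3 * k' + 3 + 2 * (1 + (a' + a' ^ 2 * k') ^ 2) := by
    exact_mod_cast hRval
  have ha1 : 1 ≤ a' := by omega
  have ha1' : (1 : ℝ) ≤ a' := by exact_mod_cast ha1
  have hPa : (P : ℝ) ≤ a' := by exact_mod_cast (by omega : P ≤ a')
  have hθ : (0 : ℝ) < 2 * a' / 2 ^ n := by positivity
  -- Here `d` is bounded by a polynomial in `n`. In the other case no circuit is wide enough for a
  -- query, so `k = 0` and `β = 0` will do.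
  by_cases hdP : d + 2 ≤ P
  · have hda : d ≤ a' := by omega
    have hda' : (d : ℝ) ≤ a' := by exact_mod_cast hda
    have hk1 : 1 ≤ k' := by rw [hkval]; omega
    have hk1' : (1 : ℝ) ≤ k' := by exact_mod_cast hk1
    have hRR : R' ≤ R' ^ 2 := Nat.le_self_pow (by norm_num) _
    have hdk : 4 * (d * k') ≤ 2 ^ n := by
      have h1 : a' ≤ a' ^ 3 := Nat.le_self_pow (by norm_num) _
      have h2 : d * k' ≤ a' ^ 3 * k' := Nat.mul_le_mul_right _ (hda.trans h1)
      have h3 : 8 * (a' ^ 3 * k') ≤ R' := by rw [hRval, ← mul_assoc]; omega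
      omega
    have hn2 : 2 ≤ n := by
      by_contra! hlt
      have : n = 1 := by omega
      subst this
      have : 5 ≤ R' := by omega
      omega
    have key := A.successProb_le hn hd hθ (β := 3 * d / 2 ^ k') (by positivity) (k := k')
      (W := P) (fun f C hC => ?_) hc hq hw
    · refine key.trans ?_
      have e1 := query_error_le ht0 hinv hd hda (by omega : P ≤ a') k'
      have e2 := circuit_error_le ht0 htsq hda hk1 (by omega : P ≤ a')
      have e3 := overload_error_le hinv hkval hdP haval
      rw [hRreal]
      linarith
    · rw [div_mul_eq_mul_div, le_div_iff₀ (by positivity)]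
      exact C.card_overloaded_le f hn2 ha1 (by omega) hdk
  · have key := A.successProb_le hn hd hθ (β := 0) le_rfl (k := 0) (W := P) (fun f C hC => ?_)
      hc hq hw
    · refine key.trans ?_
      simp only [mul_zero, add_zero, Nat.cast_zero, Real.sqrt_zero, zero_mul]
      have h1 : 2 * (1 + (P : ℝ) ^ 2) ≤ R' := by
        rw [hRreal]
        have h2 : (P : ℝ) ≤ a' + a' ^ 2 * k' := hPa.trans (le_add_of_nonneg_right (by positivity))
        have h3 : (P : ℝ) ^ 2 ≤ (a' + a' ^ 2 * k') ^ 2 := by gcongr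
        have h4 : (0 : ℝ) ≤ 8 * a' ^ 3 * k' := by positivity
        linarith
      rw [← mul_one_div]
      calc _ ≤ (R' : ℝ) * t := by gcongr
        _ ≤ _ := le_mul_of_one_le_left (by positivity) hd1
    · rw [Finset.filter_false_of_mem fun g _ =>
        C.not_overloaded_of_width_lt f hn hθ (by omega) g 0]
      simp
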